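/- Let $g\sim N(0,1)$, and for a random variable $X$ let $\|X\|_{\psi_1}:=\inf\{\lambda>0:\ \mathbb E\,(\exp(|X|/\lambda)-1)\le 1\}$. For every $K\ge 0$ there is a constant $C>0$, depending only on $K$, such that the following holds. Let $n,m,s$ be natural numbers, and let $f$ be a (possibly random) measurable real-valued link function whose randomness is independent of its argument, with $$\mu:=\operatorname{Cov}(g^2,f(g))>0,\qquad \|f(g)\|_{\psi_1}\le K .$$ Let $\mathbf x_*\in\mathbb R^n$ have at most $s$ nonzero coordinates and $\|\mathbf x_*\|_2=1$. Let $\mathbf a_1,\dots,\mathbf a_m$ be independent standard Gaussian vectors in $\mathbb R^n$, and let $y_i=f_i(\langle \mathbf a_i,\mathbf x_*\rangle)$, where $f_1,\dots,f_m$ are independent copies of $f$ that are independent of $\mathbf a_1,\dots,\mathbf a_m$ (simply $f_i=f$ if $f$ is deterministic). Put $$\hat{\boldsymbol\Sigma}=\frac1m\sum_{i=1}^m y_i(\mathbf a_i\mathbf a_i^T-\mathbf I_n).$$ Let $\hat{\mathbf x}$ be a leading unit eigenvector (a unit eigenvector for the largest eigenvalue) of a solution $\hat{\mathbf X}$ of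 $$\max_{\mathbf X\succeq 0}\ \operatorname{Tr}(\mathbf X^T\hat{\boldsymbol\Sigma})\quad\text{subject to}\quad \operatorname{Tr}\mathbf X=1,\quad \sum_{i,j}|\mathbf X_{ij}|\le s .$$ Let $\epsilon,\delta>0$, and suppose that $$m\ \ge\ C\max\left\{\frac{s^2\left(\log(n/\delta)+\log^4(s/\delta)\right)}{\mu^2\epsilon^4},\ \frac{s}{\delta},\ \log(n/\delta)\,\log^2 m\right\}.$$ Then, with probability at least $1-\delta$, such an $\hat{\mathbf x}$ exists, and every such $\hat{\mathbf x}$ (for every choice of the solution $\hat{\mathbf X}$ and of its leading unit eigenvector) satisfies $$\min\{\|\hat{\mathbf x}-\mathbf x_*\|_2,\ \|\hat{\mathbf x}+\mathbf x_*\|_2\}\le\epsilon .$$ -/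

import Mathlib

open MeasureTheory ProbabilityTheory
open scoped ENNReal NNReal

namespace MPR

/-- The Orlicz norm `inf {t > 0 : 𝔼 ψ(|X| / t) ≤ 1}` of a real random variable `X`, with values in
`[0, ∞]` (the infimum of the empty set is `∞`). -/
noncomputable def orliczNorm {Ω : Type*} [MeasurableSpace Ω] (ψ : ℝ → ℝ) (X : Ω → ℝ)
    (P : Measure Ω) : ℝ≥0∞ :=
  ⨅ t ∈ {t : ℝ≥0 | 0 < t ∧ ∫⁻ ω, ENNReal.ofReal (ψ (|X ω| / (t : ℝ))) ∂P ≤ 1}, (t : ℝ≥0∞)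

/-- The `ψ₁` (subexponential) norm: the Orlicz norm for `ψ₁ x = exp x - 1`. -/
noncomputable def psiOneNorm {Ω : Type*} [MeasurableSpace Ω] (X : Ω → ℝ) (P : Measure Ω) : ℝ≥0∞ :=
  orliczNorm (fun x => Real.exp x - 1) X P

/-- The `ψ₁` norm of `f(g)`, for `g ∼ N(0,1)` and a random link function `f(·) = f(·, ξ)` whose
randomness `ξ ∼ ν` is independent of `g`. -/
noncomputable def linkPsiOne {Ξ : Type*} [MeasurableSpace Ξ] (f : ℝ → Ξ → ℝ) (ν : Measure Ξ) :
    ℝ≥0∞ :=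
  psiOneNorm (fun p : ℝ × Ξ => f p.1 p.2) ((gaussianReal 0 1).prod ν)

/-- `μ(f, g) = Cov(g², f(g))`, for `g ∼ N(0,1)` and a random link function `f(·) = f(·, ξ)` whose
randomness `ξ ∼ ν` is independent of `g`. -/
noncomputable def linkCov {Ξ : Type*} [MeasurableSpace Ξ] (f : ℝ → Ξ → ℝ) (ν : Measure Ξ) : ℝ :=
  cov[fun p : ℝ × Ξ => p.1 ^ 2, fun p : ℝ × Ξ => f p.1 p.2; (gaussianReal 0 1).prod ν]

/-- At most `s` coordinates of `x` are nonzero. -/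
def IsSparse {n : ℕ} (s : ℕ) (x : EuclideanSpace ℝ (Fin n)) : Prop :=
  {j : Fin n | x j ≠ 0}.ncard ≤ s

/-- The reweighted sample covariance matrix `(1/m) ∑ i, y i • (a i (a i)ᵀ - I)`. -/
noncomputable def sampleCov {n m : ℕ} (a : Fin m → EuclideanSpace ℝ (Fin n)) (y : Fin m → ℝ) :
    Matrix (Fin n) (Fin n) ℝ :=
  (m : ℝ)⁻¹ • ∑ i, y i • (Matrix.vecMulVec (a i) (a i) - 1)

/-- The feasible set of the semidefinite program: positive semidefinite matrices of trace one with
entrywise `ℓ₁` norm at most `s`. -/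
def sdpFeasible (n s : ℕ) : Set (Matrix (Fin n) (Fin n) ℝ) :=
  {X | X.PosSemidef ∧ X.trace = 1 ∧ ∑ i, ∑ j, |X i j| ≤ s}

/-- `X` maximizes `⟨X, S⟩ = Tr(Xᵀ S)` over the feasible set. -/
def IsSdpSolution {n : ℕ} (s : ℕ) (S X : Matrix (Fin n) (Fin n) ℝ) : Prop :=
  X ∈ sdpFeasible n s ∧
    IsMaxOn (fun Y : Matrix (Fin n) (Fin n) ℝ => (Y.transpose * S).trace) (sdpFeasible n s) X

/-- `v` is a leading eigenvector of `X`: a unit eigenvector for the largest eigenvalue. -/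
def IsLeadingEigenvector {n : ℕ} (X : Matrix (Fin n) (Fin n) ℝ) (v : EuclideanSpace ℝ (Fin n)) :
    Prop :=
  ‖v‖ = 1 ∧ ∃ κ : ℝ, Module.End.HasEigenvector (Matrix.toEuclideanLin X) κ v ∧
    ∀ κ' : ℝ, Module.End.HasEigenvalue (Matrix.toEuclideanLin X) κ' → κ' ≤ κ

/-- `v` is a possible output of Sparse PCA with sampling vectors `a`, measurements `y` and sparsity
level `s`: a leading eigenvector of a solution of the semidefinite program. -/
def IsSparsePcaOutput {n m : ℕ} (s : ℕ) (a : Fin m → EuclideanSpace ℝ (Fin n)) (y : Fin m → ℝ)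
    (v : EuclideanSpace ℝ (Fin n)) : Prop :=
  ∃ X : Matrix (Fin n) (Fin n) ℝ, IsSdpSolution s (sampleCov a y) X ∧ IsLeadingEigenvector X v

end MPR

/-! ### Deterministic analysis of the semidefinite program. -/

namespace MPR

open Matrix

/-! The reweighted covariance has mean `μ x xᵀ`, where `μ = Cov(g², f(g))`: split a Gaussian vector
into its component along `x` and the independent orthogonal part (`integral_link_mul_gramEntry`). If
every entry of the sample matrix is within `t` of this mean, then `ℓ₁`–`ℓ∞` duality changes the
objective by at most `s t` on the feasible set. Comparing an optimal `X` with the feasible `x xᵀ`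
gives `μ (1 - xᵀ X x) ≤ 2 s t`. For `t = μ ε² / (8 s)` this is `xᵀ X x ≥ 1 - ε² / 4`, which with
trace one forces every leading eigenvector to within `ε` of `±x` (`min_norm_le_of_entrywise`).

It remains to make all entries concentrate. An entry averages products `y W` of subexponential
variables, which need not have exponential moments. Truncating at `|y| ≤ T = 4 κ log m` restores
them for parameters `|r| ≤ 1 / (16 T)`, with a variance proxy of order `κ²` independent of `T`
(`mgf_truncMul_le`). Chernoff and a union bound over the `n²` entries control the centered truncated
sums; with high probability no sample is truncated, and the truncation bias is of order `κ / m`. -/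

/-- A positive semidefinite quadratic form is at most the trace times the squared norm. -/
lemma dotProduct_mulVec_le_trace {n : ℕ} {R : Matrix (Fin n) (Fin n) ℝ} (hR : R.PosSemidef)
    (x : Fin n → ℝ) : x ⬝ᵥ R *ᵥ x ≤ R.trace * (x ⬝ᵥ x) := by
  have hsymm : ∀ i j, R j i = R i j := fun i j => by
    simpa using congrFun (congrFun hR.isHermitian i) j
  -- Test `R` on `x j • e i - x i • e j`; summing over all pairs gives twice the claim, without
  -- diagonalizing.
  have key : ∀ i j, 2 * (x i * (R i j * x j)) ≤ R i i * (x j * x j) + R j j * (x i * x i) := by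
    intro i j
    have h := (posSemidef_iff_dotProduct_mulVec.1 hR).2
      (x j • (Pi.single i (1 : ℝ)) - x i • (Pi.single j (1 : ℝ)))
    simp only [star_trivial, mulVec_sub, mulVec_smul, mulVec_single_one, sub_dotProduct,
      dotProduct_sub, smul_dotProduct, dotProduct_smul, single_one_dotProduct, smul_eq_mul,
      col_apply] at h
    rw [hsymm i j] at h
    nlinarith
  have hs : ∑ i, ∑ j, 2 * (x i * (R i j * x j)) ≤
      ∑ i, ∑ j, (R i i * (x j * x j) + R j j * (x i * x i)) :=
    Finset.sum_le_sum fun i _ => Finset.sum_le_sum fun j _ => key i j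
  have e1 : ∑ i, ∑ j, 2 * (x i * (R i j * x j)) = 2 * (x ⬝ᵥ R *ᵥ x) := by
    simp only [dotProduct, mulVec, Finset.mul_sum]
  have e2 : ∑ i, ∑ j, (R i i * (x j * x j) + R j j * (x i * x i)) =
      2 * (R.trace * (x ⬝ᵥ x)) := by
    simp only [Finset.sum_add_distrib]
    rw [Finset.sum_comm (f := fun i j => R j j * (x i * x i))]
    simp only [← Finset.mul_sum, ← Finset.sum_mul, trace, diag, dotProduct]
    ring
  linarith

/-- If `v` is a unit eigenvector of a positive semidefinite matrix `X` with eigenvalue `κ`, then the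
quadratic form of `X` at a unit vector is controlled by its component along `v`. -/
lemma quadForm_le_of_eigenvector {n : ℕ} {X : Matrix (Fin n) (Fin n) ℝ} (hX : X.PosSemidef)
    {κ : ℝ} {v x : Fin n → ℝ} (hXv : X *ᵥ v = κ • v) (hv : v ⬝ᵥ v = 1) (hx : x ⬝ᵥ x = 1) :
    x ⬝ᵥ X *ᵥ x ≤ κ * (x ⬝ᵥ v) ^ 2 + (X.trace - κ) * (1 - (x ⬝ᵥ v) ^ 2) := by
  have hT : Xᵀ = X := by simpa using hX.isHermitian.eq
  have hvX : ∀ u : Fin n → ℝ, v ⬝ᵥ X *ᵥ u = κ * (u ⬝ᵥ v) := fun u => by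
    rw [dotProduct_mulVec, ← mulVec_transpose, hT, hXv, smul_dotProduct, smul_eq_mul,
      dotProduct_comm]
  have hdec : ∀ u : Fin n → ℝ, (u - (u ⬝ᵥ v) • v) ⬝ᵥ X *ᵥ (u - (u ⬝ᵥ v) • v) =
      u ⬝ᵥ X *ᵥ u - κ * (u ⬝ᵥ v) ^ 2 := fun u => by
    simp only [mulVec_sub, mulVec_smul, sub_dotProduct, dotProduct_sub, smul_dotProduct,
      dotProduct_smul, hXv, hvX, hv, smul_eq_mul]
    ring
  have hquad : ∀ u : Fin n → ℝ, u ⬝ᵥ (X - κ • vecMulVec v v) *ᵥ u =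
      u ⬝ᵥ X *ᵥ u - κ * (u ⬝ᵥ v) ^ 2 := fun u => by
    rw [sub_mulVec, dotProduct_sub, smul_mulVec, vecMulVec_mulVec, dotProduct_smul]
    simp only [op_smul_eq_smul, dotProduct_smul, smul_eq_mul]
    rw [dotProduct_comm v u]
    ring
  -- The deflated form at `u` is the form of `X` at the projection of `u` to `v^⊥`, hence
  -- nonnegative. The trace bound for this matrix, of trace `X.trace - κ`, then controls the part of
  -- `x` orthogonal to `v`.
  have hR : (X - κ • vecMulVec v v).PosSemidef := by
    refine posSemidef_iff_dotProduct_mulVec.2 ⟨?_, fun u => ?_⟩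
    · ext i j
      have := congrFun (congrFun hT i) j
      simp only [transpose_apply] at this
      simp [vecMulVec_apply, this, mul_comm]
    · rw [star_trivial, hquad, ← hdec]
      simpa using (posSemidef_iff_dotProduct_mulVec.1 hX).2 (u - (u ⬝ᵥ v) • v)
  have h := dotProduct_mulVec_le_trace hR (x - (x ⬝ᵥ v) • v)
  have hw : (x - (x ⬝ᵥ v) • v) ⬝ᵥ v = 0 := by
    simp [sub_dotProduct, smul_dotProduct, hv]
  have hww : (x - (x ⬝ᵥ v) • v) ⬝ᵥ (x - (x ⬝ᵥ v) • v) = 1 - (x ⬝ᵥ v) ^ 2 := by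
    rw [dotProduct_sub, dotProduct_smul, hw, sub_dotProduct, hx, smul_dotProduct,
      dotProduct_comm v x]
    simp [sq]
  rw [hquad, hw, hdec, hww, trace_sub, trace_smul, trace_vecMulVec, hv] at h
  simp only [smul_eq_mul, mul_one] at h
  linarith

/-- Maximality among eigenvalues becomes a bound on the quadratic form: each eigenvalue of `κ • 1 -
X` is `κ` minus an eigenvalue of `X`, so this matrix is positive semidefinite. -/
lemma IsLeadingEigenvector.exists_eigenvalue {n : ℕ} {X : Matrix (Fin n) (Fin n) ℝ}
    (hX : X.IsHermitian) {v : EuclideanSpace ℝ (Fin n)} (hv : IsLeadingEigenvector X v) :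
    ∃ κ : ℝ, X *ᵥ v.ofLp = κ • v.ofLp ∧
      ∀ u : Fin n → ℝ, u ⬝ᵥ X *ᵥ u ≤ κ * (u ⬝ᵥ u) := by
  obtain ⟨-, κ, hκ, hmax⟩ := hv
  refine ⟨κ, ?_, fun u => ?_⟩
  · have := hκ.apply_eq_smul
    simpa using congrArg WithLp.ofLp this
  have hH : (κ • (1 : Matrix (Fin n) (Fin n) ℝ) - X).IsHermitian := by
    refine IsHermitian.sub ?_ hX
    simp [IsHermitian]
  have hpsd : (κ • (1 : Matrix (Fin n) (Fin n) ℝ) - X).PosSemidef := by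
    rw [hH.posSemidef_iff_eigenvalues_nonneg]
    intro i
    have h := hH.mulVec_eigenvectorBasis i
    have hne : hH.eigenvectorBasis i ≠ 0 := by
      intro h0
      have := (hH.eigenvectorBasis).orthonormal.1 i
      rw [h0, norm_zero] at this
      exact zero_ne_one this
    have h2 : Module.End.HasEigenvalue (Matrix.toEuclideanLin X) (κ - hH.eigenvalues i) := by
      refine Module.End.hasEigenvalue_of_hasEigenvector (x := hH.eigenvectorBasis i)
        ⟨Module.End.mem_eigenspace_iff.2 ?_, hne⟩
      refine WithLp.ofLp_injective 2 ?_
      rw [sub_mulVec, smul_mulVec, one_mulVec] at h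
      rw [ofLp_toLpLin, toLin'_apply, WithLp.ofLp_smul, sub_smul, ← h]
      abel
    have := hmax _ h2
    simp only [Pi.zero_apply]
    linarith
  have h := (posSemidef_iff_dotProduct_mulVec.1 hpsd).2 u
  rw [star_trivial, sub_mulVec, smul_mulVec, one_mulVec, dotProduct_sub, dotProduct_smul,
    smul_eq_mul] at h
  linarith

lemma exists_isLeadingEigenvector {n : ℕ} (hn : 0 < n) {X : Matrix (Fin n) (Fin n) ℝ}
    (hX : X.IsHermitian) : ∃ v, IsLeadingEigenvector X v := by
  have : Nonempty (Fin n) := ⟨⟨0, hn⟩⟩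
  obtain ⟨i, hi⟩ := Finite.exists_max hX.eigenvalues
  have hne : hX.eigenvectorBasis i ≠ 0 := by
    intro h0
    have := (hX.eigenvectorBasis).orthonormal.1 i
    rw [h0, norm_zero] at this
    exact zero_ne_one this
  refine ⟨hX.eigenvectorBasis i, (hX.eigenvectorBasis).orthonormal.1 i, hX.eigenvalues i,
    ⟨Module.End.mem_eigenspace_iff.2 ?_, hne⟩, fun κ hκ => ?_⟩
  · refine WithLp.ofLp_injective 2 ?_
    rw [ofLp_toLpLin, toLin'_apply, WithLp.ofLp_smul]
    exact hX.mulVec_eigenvectorBasis i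
  · have h := hκ.mem_spectrum
    rw [spectrum_toLpLin, hX.spectrum_real_eq_range_eigenvalues] at h
    obtain ⟨j, rfl⟩ := h
    exact hi j

/-- If a unit vector nearly maximizes the quadratic form of a positive semidefinite matrix of trace
one, then it is close, up to sign, to every leading eigenvector. -/
lemma IsLeadingEigenvector.min_norm_le {n : ℕ} {X : Matrix (Fin n) (Fin n) ℝ} (hX : X.PosSemidef)
    (htr : X.trace = 1) {v x : EuclideanSpace ℝ (Fin n)} (hv : IsLeadingEigenvector X v)
    (hx : ‖x‖ = 1) {ε : ℝ} (hε : 0 ≤ ε)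
    (h : 1 - ε ^ 2 / 4 ≤ x.ofLp ⬝ᵥ X *ᵥ x.ofLp) : min ‖v - x‖ ‖v + x‖ ≤ ε := by
  obtain ⟨κ, hXv, hκ⟩ := hv.exists_eigenvalue hX.isHermitian
  have hdot : ∀ u w : EuclideanSpace ℝ (Fin n), inner ℝ u w = u.ofLp ⬝ᵥ w.ofLp := fun u w => by
    rw [EuclideanSpace.inner_eq_star_dotProduct, star_trivial, dotProduct_comm]
  have hvv : v.ofLp ⬝ᵥ v.ofLp = 1 := by rw [← hdot, real_inner_self_eq_norm_sq, hv.1, one_pow]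
  have hxx : x.ofLp ⬝ᵥ x.ofLp = 1 := by rw [← hdot, real_inner_self_eq_norm_sq, hx, one_pow]
  have h1 := quadForm_le_of_eigenvector hX hXv hvv hxx
  have h2 := hκ x.ofLp
  have hκ1 : κ ≤ 1 := by
    have h3 := dotProduct_mulVec_le_trace hX v.ofLp
    rw [hXv, dotProduct_smul, hvv, htr, smul_eq_mul] at h3
    linarith
  rw [hxx] at h2
  rw [htr, ← hdot x v] at h1
  set c := inner ℝ x v with hc
  have hc1 : |c| ≤ 1 := by
    have := abs_real_inner_le_norm x v
    rwa [hx, hv.1, one_mul] at this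
  have hcsq : c ^ 2 = |c| ^ 2 := (sq_abs c).symm
  -- By `h1`, `1 - ε² / 4 ≤ κ c² + (1 - κ)(1 - c²) ≤ |c| + (1 - κ)`, and `h2` gives `1 - κ ≤ ε² /
  -- 4`. Up to sign, the squared distance is `2 - 2 |c|`.
  have hcc : 1 - ε ^ 2 / 2 ≤ |c| := by
    rw [hcsq] at h1
    nlinarith [abs_nonneg c, sq_nonneg c, mul_nonneg (sub_nonneg.2 hκ1) (sq_nonneg |c|),
      mul_nonneg (sub_nonneg.2 hκ1) (sub_nonneg.2 hc1), mul_nonneg (abs_nonneg c) (sub_nonneg.2 hc1)]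
  rcases le_total 0 c with h0 | h0
  · refine (min_le_left _ _).trans (abs_le_of_sq_le_sq' ?_ hε).2
    rw [norm_sub_sq_real, hv.1, hx, real_inner_comm, ← hc]
    rw [abs_of_nonneg h0] at hcc
    linarith
  · refine (min_le_right _ _).trans (abs_le_of_sq_le_sq' ?_ hε).2
    rw [norm_add_sq_real, hv.1, hx, real_inner_comm, ← hc]
    rw [abs_of_nonpos h0] at hcc
    linarith

/-- The entrywise norm of `x xᵀ` is the square of the `ℓ₁` norm of `x`, at most `s` by
Cauchy–Schwarz on the support. -/
lemma vecMulVec_mem_sdpFeasible {n s : ℕ} {x : EuclideanSpace ℝ (Fin n)} (hs : IsSparse s x)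
    (hx : ‖x‖ = 1) : vecMulVec x.ofLp x.ofLp ∈ sdpFeasible n s := by
  have hsq : ∑ i, x i ^ 2 = 1 := by
    rw [← EuclideanSpace.real_norm_sq_eq, hx, one_pow]
  refine ⟨?_, ?_, ?_⟩
  · simpa using posSemidef_vecMulVec_self_star x.ofLp
  · rw [trace_vecMulVec, ← hsq]
    simp [dotProduct, sq]
  · classical
    set S : Finset (Fin n) := Finset.univ.filter fun j => x j ≠ 0 with hS
    have hcard : (S.card : ℝ) ≤ s := by
      have : {j : Fin n | x j ≠ 0}.ncard = S.card := by
        rw [hS, ← Set.ncard_coe_finset]; congr 1; ext; simp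
      unfold IsSparse at hs
      rw [this] at hs
      exact_mod_cast hs
    have e : ∑ i, ∑ j, |vecMulVec x.ofLp x.ofLp i j| = (∑ i, |x i|) ^ 2 := by
      simp only [vecMulVec_apply, abs_mul, sq, Finset.sum_mul_sum]
    have e2 : ∑ i, |x i| = ∑ i ∈ S, |x i| := by
      rw [hS, Finset.sum_filter]
      refine Finset.sum_congr rfl fun i _ => ?_
      by_cases h : x i = 0 <;> simp [h]
    rw [e, e2]
    calc (∑ i ∈ S, |x i|) ^ 2 ≤ S.card * ∑ i ∈ S, |x i| ^ 2 := sq_sum_le_card_mul_sum_sq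
      _ ≤ S.card * ∑ i, |x i| ^ 2 := by
          gcongr
          exact Finset.subset_univ S
      _ = S.card := by simp [hsq]
      _ ≤ s := hcard

lemma isCompact_sdpFeasible (n s : ℕ) : IsCompact (sdpFeasible n s) := by
  have hcl : IsClosed (sdpFeasible n s) := by
    have h1 : IsClosed {X : Matrix (Fin n) (Fin n) ℝ | X.PosSemidef} := by
      simp only [posSemidef_iff_dotProduct_mulVec, IsHermitian, Set.ofPred_and, Set.ofPred_forall]
      refine IsClosed.inter (isClosed_eq (by fun_prop) (by fun_prop))
        (isClosed_iInter fun x => isClosed_le (by fun_prop) ?_)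
      fun_prop
    have h2 : IsClosed {X : Matrix (Fin n) (Fin n) ℝ | X.trace = 1} :=
      isClosed_eq (by fun_prop) (by fun_prop)
    have h3 : IsClosed {X : Matrix (Fin n) (Fin n) ℝ | ∑ i, ∑ j, |X i j| ≤ s} :=
      isClosed_le (by fun_prop) (by fun_prop)
    exact h1.inter (h2.inter h3)
  have hK : IsCompact (Set.univ.pi fun _ : Fin n => Set.univ.pi fun _ : Fin n =>
      Set.Icc (-(s : ℝ)) s) :=
    isCompact_univ_pi fun _ => isCompact_univ_pi fun _ => isCompact_Icc
  refine hK.of_isClosed_subset hcl fun X hX => ?_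
  refine Set.mem_univ_pi.2 fun i => Set.mem_univ_pi.2 fun j => abs_le.1 ?_
  refine le_trans ?_ hX.2.2
  exact (Finset.single_le_sum (f := fun j => |X i j|) (fun _ _ => abs_nonneg _)
    (Finset.mem_univ j)).trans (Finset.single_le_sum (f := fun i => ∑ j, |X i j|)
    (fun _ _ => Finset.sum_nonneg fun _ _ => abs_nonneg _) (Finset.mem_univ i))

lemma exists_isSparsePcaOutput {n m s : ℕ} (hn : 0 < n) {x : EuclideanSpace ℝ (Fin n)}
    (hs : IsSparse s x) (hx : ‖x‖ = 1) (a : Fin m → EuclideanSpace ℝ (Fin n)) (y : Fin m → ℝ) :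
    ∃ v, IsSparsePcaOutput s a y v := by
  obtain ⟨X, hX, hmax⟩ := (isCompact_sdpFeasible n s).exists_isMaxOn
    ⟨_, vecMulVec_mem_sdpFeasible hs hx⟩
    (f := fun Y : Matrix (Fin n) (Fin n) ℝ => (Y.transpose * sampleCov a y).trace)
    (Continuous.continuousOn (by fun_prop))
  obtain ⟨v, hv⟩ := exists_isLeadingEigenvector hn hX.1.isHermitian
  exact ⟨v, X, ⟨hX, hmax⟩, hv⟩

lemma trace_transpose_mul_eq_sum {n : ℕ} (Y S : Matrix (Fin n) (Fin n) ℝ) :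
    (Yᵀ * S).trace = ∑ i, ∑ j, Y i j * S i j := by
  simp only [trace, diag, mul_apply, transpose_apply]
  exact Finset.sum_comm

/-- A leading eigenvector of a solution of the semidefinite program is close to `x`, up to sign, if
the objective is entrywise close to a multiple of `x xᵀ`. -/
lemma min_norm_le_of_entrywise {n s : ℕ} {x v : EuclideanSpace ℝ (Fin n)} (hs : IsSparse s x)
    (hx : ‖x‖ = 1) {S X : Matrix (Fin n) (Fin n) ℝ} {μ t ε : ℝ} (hμ : 0 < μ) (hε : 0 ≤ ε)
    (hS : ∀ i j, |S i j - μ * (x i * x j)| ≤ t) (ht : 8 * s * t ≤ μ * ε ^ 2)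
    (hX : IsSdpSolution s S X) (hv : IsLeadingEigenvector X v) :
    min ‖v - x‖ ‖v + x‖ ≤ ε := by
  have hfeas := vecMulVec_mem_sdpFeasible hs hx
  refine hv.min_norm_le hX.1.1 hX.1.2.1 hx hε ?_
  -- Duality between the entrywise `ℓ₁` norm of `Y` and the entrywise maximum of the error.
  have hsplit : ∀ Y ∈ sdpFeasible n s,
      |(Yᵀ * S).trace - μ * (x.ofLp ⬝ᵥ Y *ᵥ x.ofLp)| ≤ t * s := by
    intro Y hY
    have e : (Yᵀ * S).trace - μ * (x.ofLp ⬝ᵥ Y *ᵥ x.ofLp) =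
        ∑ i, ∑ j, Y i j * (S i j - μ * (x i * x j)) := by
      rw [trace_transpose_mul_eq_sum]
      simp only [dotProduct, mulVec, Finset.mul_sum, ← Finset.sum_sub_distrib]
      refine Finset.sum_congr rfl fun i _ => Finset.sum_congr rfl fun j _ => ?_
      ring
    have ht0 : 0 ≤ t := by
      have : Nonempty (Fin n) := by
        by_contra hcon
        rw [not_nonempty_iff] at hcon
        rw [Subsingleton.elim x 0, norm_zero] at hx
        exact zero_ne_one hx
      exact (abs_nonneg _).trans (hS this.some this.some)
    rw [e]
    calc |∑ i, ∑ j, Y i j * (S i j - μ * (x i * x j))|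
        ≤ ∑ i, ∑ j, |Y i j * (S i j - μ * (x i * x j))| :=
          (Finset.abs_sum_le_sum_abs _ _).trans
            (Finset.sum_le_sum fun i _ => Finset.abs_sum_le_sum_abs _ _)
      _ ≤ ∑ i, ∑ j, t * |Y i j| := by
          refine Finset.sum_le_sum fun i _ => Finset.sum_le_sum fun j _ => ?_
          rw [abs_mul, mul_comm]
          exact mul_le_mul_of_nonneg_right (hS i j) (abs_nonneg _)
      _ = t * ∑ i, ∑ j, |Y i j| := by simp only [Finset.mul_sum]
      _ ≤ t * s := mul_le_mul_of_nonneg_left hY.2.2 ht0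
  have h1 := abs_le.1 (hsplit X hX.1)
  have h2 := abs_le.1 (hsplit _ hfeas)
  have h3 : (_ : ℝ) ≤ _ := hX.2 hfeas
  have hxx : x.ofLp ⬝ᵥ x.ofLp = 1 := by
    have : inner ℝ x x = x.ofLp ⬝ᵥ x.ofLp := by
      rw [EuclideanSpace.inner_eq_star_dotProduct, star_trivial]
    rw [← this, real_inner_self_eq_norm_sq, hx, one_pow]
  have h4 : x.ofLp ⬝ᵥ vecMulVec x.ofLp x.ofLp *ᵥ x.ofLp = 1 := by
    rw [vecMulVec_mulVec, hxx]
    simp [hxx]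
  rw [h4] at h2
  have h5 : μ * (1 - ε ^ 2 / 4) ≤ μ * (x.ofLp ⬝ᵥ X *ᵥ x.ofLp) := by
    simp only at h3
    linarith [h1.2, h2.1]
  exact le_of_mul_le_mul_left h5 hμ

end MPR

/-! ### Truncated products of subexponential variables and Chernoff's bound. -/

namespace MPR

lemma exp_le_one_add_add_sq_mul_exp_abs (u : ℝ) :
    Real.exp u ≤ 1 + u + u ^ 2 * Real.exp |u| := by
  have h1 : 1 ≤ Real.exp |u| := Real.one_le_exp (abs_nonneg u)
  rcases le_or_gt |u| 1 with hu | hu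
  · have := (abs_le.1 (Real.abs_exp_sub_one_sub_id_le hu)).2
    nlinarith [sq_nonneg u]
  · rcases lt_abs.1 hu with h | h
    · rw [abs_of_pos (by linarith)]
      nlinarith [mul_pos (Real.exp_pos u) (mul_pos (sub_pos.2 h) (show (0 : ℝ) < u + 1 by linarith))]
    · rw [abs_of_neg (by linarith)]
      have h2 := Real.add_one_le_exp (-u)
      have h3 : Real.exp u ≤ 1 := Real.exp_le_one_iff.2 (by linarith)
      nlinarith [mul_le_mul_of_nonneg_left h2 (sq_nonneg u)]

/-- Trades a polynomial factor for a small exponential rate; the numerical constants below are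
products of such `c`. -/
lemma le_mul_exp_div {c u : ℝ} (hc : 0 < c) : u ≤ c * Real.exp (u / c) := by
  have h := Real.add_one_le_exp (u / c)
  calc u = c * (u / c) := by field_simp
    _ ≤ c * Real.exp (u / c) := by gcongr; linarith

section TruncatedProduct

variable {α : Type*} {y W : α → ℝ} {κ : ℝ}

/-- The truncation of the product `y * W` at the level `|y| ≤ T`. -/
noncomputable def truncMul (y W : α → ℝ) (T : ℝ) (p : α) : ℝ :=
  if |y p| ≤ T then y p * W p else 0

/-- The average of the exponentials that dominate the product of two subexponential variables. -/
noncomputable def expMajorant (y W : α → ℝ) (κ : ℝ) (p : α) : ℝ :=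
  (Real.exp (|y p| / κ) + Real.exp (|W p| / 4)) / 2

/-- AM–GM at half the rates: only the separate exponential moments of `y` and `W` matter, so their
dependence is harmless. -/
lemma exp_mul_exp_le_expMajorant (p : α) :
    Real.exp (|y p| / (2 * κ)) * Real.exp (|W p| / 8) ≤ expMajorant y W κ p := by
  have h1 : Real.exp (|y p| / κ) = Real.exp (|y p| / (2 * κ)) ^ 2 := by
    rw [← Real.exp_nat_mul]; congr 1; rw [div_mul_eq_div_div]; push_cast; ring
  have h2 : Real.exp (|W p| / 4) = Real.exp (|W p| / 8) ^ 2 := by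
    rw [← Real.exp_nat_mul]; congr 1; push_cast; ring
  rw [expMajorant, h1, h2]
  nlinarith [sq_nonneg (Real.exp (|y p| / (2 * κ)) - Real.exp (|W p| / 8))]

lemma abs_mul_le_expMajorant (hκ : 0 < κ) (p : α) :
    |y p * W p| ≤ 16 * κ * expMajorant y W κ p := by
  have h1 : |y p| ≤ 2 * κ * Real.exp (|y p| / (2 * κ)) := le_mul_exp_div (by positivity)
  have h2 : |W p| ≤ 8 * Real.exp (|W p| / 8) := le_mul_exp_div (by positivity)
  calc |y p * W p| = |y p| * |W p| := abs_mul _ _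
    _ ≤ (2 * κ * Real.exp (|y p| / (2 * κ))) * (8 * Real.exp (|W p| / 8)) := by gcongr
    _ = 16 * κ * (Real.exp (|y p| / (2 * κ)) * Real.exp (|W p| / 8)) := by ring
    _ ≤ _ := by gcongr; exact exp_mul_exp_le_expMajorant p

/-- Of the available rate `1/8` in `|W|`, half absorbs `W²` and half carries the factor `exp (|W| /
16)`. The constant is `(4 κ * 32)²`. -/
lemma sq_mul_exp_le_expMajorant (hκ : 0 < κ) (p : α) :
    (y p * W p) ^ 2 * Real.exp (|W p| / 16) ≤ 16384 * κ ^ 2 * expMajorant y W κ p := by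
  have h1 : |y p| ≤ 4 * κ * Real.exp (|y p| / (4 * κ)) := le_mul_exp_div (by positivity)
  have h2 : |W p| ≤ 32 * Real.exp (|W p| / 32) := le_mul_exp_div (by positivity)
  have e1 : Real.exp (|y p| / (2 * κ)) = Real.exp (|y p| / (4 * κ)) ^ 2 := by
    rw [← Real.exp_nat_mul]; congr 1; field_simp; push_cast; ring
  have e2 : Real.exp (|W p| / 8) = Real.exp (|W p| / 32) ^ 2 * Real.exp (|W p| / 16) := by
    rw [← Real.exp_nat_mul, ← Real.exp_add]; congr 1; push_cast; ring
  calc (y p * W p) ^ 2 * Real.exp (|W p| / 16)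
      = (|y p| * |W p|) ^ 2 * Real.exp (|W p| / 16) := by rw [← abs_mul, sq_abs]
    _ ≤ ((4 * κ * Real.exp (|y p| / (4 * κ))) * (32 * Real.exp (|W p| / 32))) ^ 2 *
          Real.exp (|W p| / 16) := by gcongr
    _ = 16384 * κ ^ 2 * (Real.exp (|y p| / (2 * κ)) * Real.exp (|W p| / 8)) := by
        rw [e1, e2]; ring
    _ ≤ _ := by gcongr; exact exp_mul_exp_le_expMajorant p

lemma abs_truncMul_le (T : ℝ) (p : α) : |truncMul y W T p| ≤ |y p * W p| := by
  unfold truncMul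
  split_ifs
  · exact le_rfl
  · rw [abs_zero]; exact abs_nonneg _

/-- Truncation makes the exponent at most `|W| / 16`, so the second-order Taylor remainder is
integrable, with a bound free of `T`. -/
lemma exp_mul_truncMul_le (hκ : 0 < κ) {T r : ℝ} (hr : |r| * T ≤ 1 / 16) (p : α) :
    Real.exp (r * truncMul y W T p) ≤
      1 + r * truncMul y W T p + r ^ 2 * (16384 * κ ^ 2 * expMajorant y W κ p) := by
  refine (exp_le_one_add_add_sq_mul_exp_abs _).trans ?_
  have h1 : |r * truncMul y W T p| ≤ |W p| / 16 := by
    unfold truncMul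
    split_ifs with h
    · rw [abs_mul, abs_mul, ← mul_assoc]
      calc |r| * |y p| * |W p| ≤ |r| * T * |W p| := by gcongr
        _ ≤ 1 / 16 * |W p| := by gcongr
        _ = |W p| / 16 := by ring
    · simp only [mul_zero, abs_zero]; positivity
  have h2 : truncMul y W T p ^ 2 ≤ (y p * W p) ^ 2 := sq_le_sq.2 (abs_truncMul_le T p)
  have h3 : (r * truncMul y W T p) ^ 2 * Real.exp |r * truncMul y W T p| ≤
      r ^ 2 * (16384 * κ ^ 2 * expMajorant y W κ p) := by
    calc (r * truncMul y W T p) ^ 2 * Real.exp |r * truncMul y W T p|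
        = r ^ 2 * (truncMul y W T p ^ 2 * Real.exp |r * truncMul y W T p|) := by ring
      _ ≤ r ^ 2 * ((y p * W p) ^ 2 * Real.exp (|W p| / 16)) := by gcongr
      _ ≤ _ := mul_le_mul_of_nonneg_left (sq_mul_exp_le_expMajorant hκ p) (sq_nonneg r)
  linarith

variable [MeasurableSpace α] {Q : Measure α}

lemma integrable_expMajorant (hyi : Integrable (fun p => Real.exp (|y p| / κ)) Q)
    (hWi : Integrable (fun p => Real.exp (|W p| / 4)) Q) : Integrable (expMajorant y W κ) Q :=
  (hyi.add hWi).div_const 2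

lemma integral_expMajorant_le (hyi : Integrable (fun p => Real.exp (|y p| / κ)) Q)
    (hWi : Integrable (fun p => Real.exp (|W p| / 4)) Q)
    (hy : ∫ p, Real.exp (|y p| / κ) ∂Q ≤ 2) (hW : ∫ p, Real.exp (|W p| / 4) ∂Q ≤ 2) :
    ∫ p, expMajorant y W κ p ∂Q ≤ 2 := by
  unfold expMajorant
  rw [integral_div, integral_add hyi hWi]
  linarith

lemma measurable_truncMul (hym : Measurable y) (hWm : Measurable W) (T : ℝ) :
    Measurable (truncMul y W T) :=
  Measurable.ite (measurableSet_le hym.abs measurable_const) (hym.mul hWm) measurable_const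

lemma integrable_mul_of_exp (hκ : 0 < κ) (hym : Measurable y) (hWm : Measurable W)
    (hyi : Integrable (fun p => Real.exp (|y p| / κ)) Q)
    (hWi : Integrable (fun p => Real.exp (|W p| / 4)) Q) : Integrable (fun p => y p * W p) Q :=
  ((integrable_expMajorant hyi hWi).const_mul (16 * κ)).mono'
    (hym.mul hWm).aestronglyMeasurable (.of_forall fun p => abs_mul_le_expMajorant hκ p)

lemma integrable_truncMul (hκ : 0 < κ) (hym : Measurable y) (hWm : Measurable W)
    (hyi : Integrable (fun p => Real.exp (|y p| / κ)) Q)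
    (hWi : Integrable (fun p => Real.exp (|W p| / 4)) Q) (T : ℝ) :
    Integrable (truncMul y W T) Q :=
  (integrable_mul_of_exp hκ hym hWm hyi hWi).mono
    (measurable_truncMul hym hWm T).aestronglyMeasurable (.of_forall fun p => abs_truncMul_le T p)

lemma measureReal_lt_abs_le [IsFiniteMeasure Q] (hκ : 0 < κ)
    (hyi : Integrable (fun p => Real.exp (|y p| / κ)) Q)
    (hy : ∫ p, Real.exp (|y p| / κ) ∂Q ≤ 2) (T : ℝ) :
    Q.real {p | T < |y p|} ≤ 2 * Real.exp (-(T / κ)) := by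
  have h := mul_meas_ge_le_integral_of_nonneg (.of_forall fun p => Real.exp_nonneg _) hyi
    (Real.exp (T / κ))
  have h2 : Q.real {p | T < |y p|} ≤ Q.real {p | Real.exp (T / κ) ≤ Real.exp (|y p| / κ)} := by
    refine measureReal_mono fun p (hp : T < |y p|) => ?_
    exact Real.exp_le_exp.2 (by gcongr)
  have h3 : Real.exp (T / κ) * Q.real {p | T < |y p|} ≤ 2 :=
    (mul_le_mul_of_nonneg_left h2 (Real.exp_nonneg _)).trans (h.trans hy)
  rw [Real.exp_neg, ← div_eq_mul_inv, le_div_iff₀ (Real.exp_pos _), mul_comm]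
  exact h3

/-- The bias caused by the truncation is exponentially small in the truncation level. -/
lemma abs_integral_truncMul_sub_le (hκ : 0 < κ) (hym : Measurable y) (hWm : Measurable W)
    (hyi : Integrable (fun p => Real.exp (|y p| / κ)) Q)
    (hWi : Integrable (fun p => Real.exp (|W p| / 4)) Q)
    (hy : ∫ p, Real.exp (|y p| / κ) ∂Q ≤ 2) (hW : ∫ p, Real.exp (|W p| / 4) ∂Q ≤ 2) (T : ℝ) :
    |∫ p, truncMul y W T p ∂Q - ∫ p, y p * W p ∂Q| ≤ 64 * κ * Real.exp (-(T / (4 * κ))) := by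
  rw [← integral_sub (integrable_truncMul hκ hym hWm hyi hWi T)
    (integrable_mul_of_exp hκ hym hWm hyi hWi)]
  have hpt : ∀ p, ‖truncMul y W T p - y p * W p‖ ≤
      32 * κ * Real.exp (-(T / (4 * κ))) * expMajorant y W κ p := by
    intro p
    have hM0 : 0 ≤ expMajorant y W κ p := by unfold expMajorant; positivity
    unfold truncMul
    split_ifs with h
    · rw [sub_self, norm_zero]; positivity
    · push Not at h
      rw [zero_sub, norm_neg, Real.norm_eq_abs, abs_mul]
      have h1 : |y p| ≤ 4 * κ * Real.exp (|y p| / (4 * κ)) := le_mul_exp_div (by positivity)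
      have h2 : |W p| ≤ 8 * Real.exp (|W p| / 8) := le_mul_exp_div (by positivity)
      -- Since `T < |y p|`, this factor can be inserted; it supplies the decay at the cost of rate
      -- `1 / (4 κ)` in `|y p|`.
      have h3 : 1 ≤ Real.exp (-(T / (4 * κ))) * Real.exp (|y p| / (4 * κ)) := by
        rw [← Real.exp_add]
        refine Real.one_le_exp ?_
        have : T / (4 * κ) ≤ |y p| / (4 * κ) := by gcongr
        linarith
      have e1 : Real.exp (|y p| / (2 * κ)) = Real.exp (|y p| / (4 * κ)) ^ 2 := by
        rw [← Real.exp_nat_mul]; congr 1; field_simp; push_cast; ring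
      calc |y p| * |W p|
          ≤ (4 * κ * Real.exp (|y p| / (4 * κ))) * (8 * Real.exp (|W p| / 8)) := by gcongr
        _ ≤ (Real.exp (-(T / (4 * κ))) * Real.exp (|y p| / (4 * κ))) *
              ((4 * κ * Real.exp (|y p| / (4 * κ))) * (8 * Real.exp (|W p| / 8))) :=
            le_mul_of_one_le_left (by positivity) h3
        _ = 32 * κ * Real.exp (-(T / (4 * κ))) *
              (Real.exp (|y p| / (2 * κ)) * Real.exp (|W p| / 8)) := by rw [e1]; ring
        _ ≤ _ := by gcongr; exact exp_mul_exp_le_expMajorant p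
  calc |∫ p, (truncMul y W T p - y p * W p) ∂Q|
      ≤ ∫ p, 32 * κ * Real.exp (-(T / (4 * κ))) * expMajorant y W κ p ∂Q :=
        norm_integral_le_of_norm_le ((integrable_expMajorant hyi hWi).const_mul _)
          (.of_forall hpt)
    _ = 32 * κ * Real.exp (-(T / (4 * κ))) * ∫ p, expMajorant y W κ p ∂Q := integral_const_mul _ _
    _ ≤ 32 * κ * Real.exp (-(T / (4 * κ))) * 2 := by
        gcongr; exact integral_expMajorant_le hyi hWi hy hW
    _ = _ := by ring

/-- The centered truncated product is subgaussian at the scale of the inverse truncation level. -/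
lemma mgf_truncMul_le [IsProbabilityMeasure Q] (hκ : 0 < κ) (hym : Measurable y) (hWm : Measurable W)
    (hyi : Integrable (fun p => Real.exp (|y p| / κ)) Q)
    (hWi : Integrable (fun p => Real.exp (|W p| / 4)) Q)
    (hy : ∫ p, Real.exp (|y p| / κ) ∂Q ≤ 2) (hW : ∫ p, Real.exp (|W p| / 4) ∂Q ≤ 2)
    {T r : ℝ} (hr : |r| * T ≤ 1 / 16) :
    Integrable (fun p => Real.exp (r * (truncMul y W T p - ∫ q, truncMul y W T q ∂Q))) Q ∧
      mgf (fun p => truncMul y W T p - ∫ q, truncMul y W T q ∂Q) Q r ≤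
        Real.exp (32768 * κ ^ 2 * r ^ 2) := by
  set V := truncMul y W T with hV
  set c := ∫ q, V q ∂Q with hc
  have hVi : Integrable V Q := integrable_truncMul hκ hym hWm hyi hWi T
  have hM := integrable_expMajorant hyi hWi
  have hmaj : Integrable
      (fun p => 1 + r * V p + r ^ 2 * (16384 * κ ^ 2 * expMajorant y W κ p)) Q :=
    ((integrable_const _).add (hVi.const_mul r)).add ((hM.const_mul _).const_mul _)
  have hexp : Integrable (fun p => Real.exp (r * V p)) Q := by
    refine hmaj.mono' ?_ (.of_forall fun p => ?_)
    · exact (((measurable_truncMul hym hWm T).const_mul r).exp).aestronglyMeasurable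
    · rw [Real.norm_of_nonneg (Real.exp_nonneg _)]
      exact exp_mul_truncMul_le hκ hr p
  have hsplit : (fun p => Real.exp (r * (V p - c))) =
      fun p => Real.exp (-(r * c)) * Real.exp (r * V p) := by
    ext p; rw [← Real.exp_add]; congr 1; ring
  refine ⟨by rw [hsplit]; exact hexp.const_mul _, ?_⟩
  rw [mgf, hsplit, integral_const_mul]
  have hle : ∫ p, Real.exp (r * V p) ∂Q ≤ 1 + r * c + 32768 * κ ^ 2 * r ^ 2 := by
    calc ∫ p, Real.exp (r * V p) ∂Q
        ≤ ∫ p, (1 + r * V p + r ^ 2 * (16384 * κ ^ 2 * expMajorant y W κ p)) ∂Q :=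
          integral_mono hexp hmaj fun p => exp_mul_truncMul_le hκ hr p
      _ = 1 + r * c + r ^ 2 * (16384 * κ ^ 2 * ∫ p, expMajorant y W κ p ∂Q) := by
          rw [integral_add (by fun_prop) (by fun_prop), integral_add (by fun_prop) (by fun_prop),
            integral_const_mul, integral_const_mul, integral_const_mul]
          simp [hc]
      _ ≤ 1 + r * c + r ^ 2 * (16384 * κ ^ 2 * 2) := by
          gcongr; exact integral_expMajorant_le hyi hWi hy hW
      _ = _ := by ring
  calc Real.exp (-(r * c)) * ∫ p, Real.exp (r * V p) ∂Q
      ≤ Real.exp (-(r * c)) * Real.exp (r * c + 32768 * κ ^ 2 * r ^ 2) := by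
        gcongr
        refine hle.trans ?_
        have := Real.add_one_le_exp (r * c + 32768 * κ ^ 2 * r ^ 2)
        linarith
    _ = _ := by rw [← Real.exp_add]; congr 1; ring

end TruncatedProduct

/-- Chernoff's bound for a sum of independent copies. -/
lemma measureReal_le_sum_le {α Ω : Type*} [MeasurableSpace α] [MeasurableSpace Ω] {P : Measure Ω}
    {Q : Measure α} [IsProbabilityMeasure Q] {m : ℕ} {Z : Fin m → Ω → α} (hind : iIndepFun Z P)
    (hlaw : ∀ i, HasLaw (Z i) Q P) {U : α → ℝ} (hU : Measurable U) {r b : ℝ} (hr : 0 ≤ r)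
    (hint : Integrable (fun p => Real.exp (r * U p)) Q) (hmgf : mgf U Q r ≤ Real.exp b) (u : ℝ) :
    P.real {ω | u ≤ ∑ i, U (Z i ω)} ≤ Real.exp (-(r * u) + m * b) := by
  have := hind.isProbabilityMeasure
  have hind' : iIndepFun (fun i => U ∘ Z i) P := hind.comp (fun _ => U) fun _ => hU
  have hae : ∀ i, AEMeasurable (U ∘ Z i) P := fun i => hU.comp_aemeasurable (hlaw i).aemeasurable
  have hexpm : AEStronglyMeasurable (fun p => Real.exp (r * U p)) Q :=
    (hU.const_mul r).exp.aestronglyMeasurable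
  have hm : ∀ i, mgf (U ∘ Z i) P r = mgf U Q r := fun i => (hlaw i).integral_comp hexpm
  -- A nonintegrable function has Bochner integral zero, so positivity of the product of the moment
  -- generating functions yields integrability.
  have hi : Integrable (fun ω => Real.exp (r * (∑ i, U ∘ Z i) ω)) P := by
    refine Integrable.of_integral_ne_zero ?_
    change mgf (∑ i, U ∘ Z i) P r ≠ 0
    rw [hind'.mgf_sum₀ hae]
    exact Finset.prod_ne_zero_iff.2 fun i _ => by rw [hm i]; exact (mgf_pos hint).ne'
  have h := measure_ge_le_exp_mul_mgf u hr hi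
  rw [hind'.mgf_sum₀ hae] at h
  simp only [hm, Finset.prod_const, Finset.card_univ, Fintype.card_fin, Finset.sum_apply,
    Function.comp_apply] at h
  refine h.trans ?_
  rw [Real.exp_add, Real.exp_nat_mul, neg_mul]
  gcongr
  exact integral_nonneg fun _ => Real.exp_nonneg _

end MPR

/-! ### Gaussian vectors, exponential moments and the population matrix. -/

namespace MPR

section GaussianVector

variable {n : ℕ}

lemma memLp_inner_stdGaussian (u : EuclideanSpace ℝ (Fin n)) {p : ℝ≥0∞} (hp : p ≠ ∞) :
    MemLp (fun a => inner ℝ u a) p (stdGaussian (EuclideanSpace ℝ (Fin n))) :=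
  (IsGaussian.hasGaussianLaw_id.map_fun (innerSL ℝ u)).memLp hp

lemma integral_inner_stdGaussian (u : EuclideanSpace ℝ (Fin n)) :
    ∫ a, inner ℝ u a ∂stdGaussian (EuclideanSpace ℝ (Fin n)) = 0 :=
  integral_strongDual_stdGaussian (innerSL ℝ u)

lemma covariance_inner_stdGaussian (u w : EuclideanSpace ℝ (Fin n)) :
    cov[fun a => inner ℝ u a, fun a => inner ℝ w a; stdGaussian (EuclideanSpace ℝ (Fin n))] =
      inner ℝ u w := by
  rw [← covarianceBilin_apply_eq_cov IsGaussian.memLp_two_id, covarianceBilin_stdGaussian]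
  rfl

lemma integral_inner_mul_inner_stdGaussian (u w : EuclideanSpace ℝ (Fin n)) :
    ∫ a, inner ℝ u a * inner ℝ w a ∂stdGaussian (EuclideanSpace ℝ (Fin n)) = inner ℝ u w := by
  have h := covariance_eq_sub (memLp_inner_stdGaussian u (p := 2) (by simp))
    (memLp_inner_stdGaussian w (p := 2) (by simp))
  rw [covariance_inner_stdGaussian, integral_inner_stdGaussian, zero_mul, sub_zero] at h
  exact h.symm

lemma hasLaw_inner_stdGaussian {u : EuclideanSpace ℝ (Fin n)} (hu : ‖u‖ = 1) :
    HasLaw (fun a => inner ℝ u a) (gaussianReal 0 1) (stdGaussian (EuclideanSpace ℝ (Fin n))) := by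
  refine ⟨by fun_prop, ?_⟩
  have h := (IsGaussian.hasGaussianLaw_id
    (μ := stdGaussian (EuclideanSpace ℝ (Fin n)))).map_fun (innerSL ℝ u)
  have h2 := h.map_eq_gaussianReal
  simp only [id, innerSL_apply_apply] at h2
  rw [h2, integral_inner_stdGaussian, ← covariance_self (by fun_prop), covariance_inner_stdGaussian,
    real_inner_self_eq_norm_sq, hu]
  simp

/-- The component of a standard Gaussian vector along a unit vector is independent of the orthogonal
component. -/
lemma indepFun_inner_sub_smul {x : EuclideanSpace ℝ (Fin n)} (hx : ‖x‖ = 1) :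
    IndepFun (fun a => inner ℝ x a) (fun a => a - inner ℝ x a • x)
      (stdGaussian (EuclideanSpace ℝ (Fin n))) := by
  have hG := (IsGaussian.hasGaussianLaw_id
    (μ := stdGaussian (EuclideanSpace ℝ (Fin n)))).map_fun
    ((innerSL ℝ x).prod (ContinuousLinearMap.id ℝ _ - (innerSL ℝ x).smulRight x))
  refine HasGaussianLaw.indepFun_of_covariance_inner (by simpa using hG) fun r w => ?_
  have e1 : (fun a : EuclideanSpace ℝ (Fin n) => inner ℝ r (inner ℝ x a : ℝ)) =
      fun a => inner ℝ (r • x) a := by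
    ext a; rw [real_inner_smul_left]; simp [mul_comm]
  have e2 : (fun a : EuclideanSpace ℝ (Fin n) => inner ℝ w (a - inner ℝ x a • x)) =
      fun a => inner ℝ (w - (inner ℝ w x : ℝ) • x) a := by
    ext a; rw [inner_sub_right, inner_sub_left, real_inner_smul_right, real_inner_smul_left]; ring
  rw [e1, e2, covariance_inner_stdGaussian, real_inner_smul_left, inner_sub_right,
    real_inner_smul_right, real_inner_self_eq_norm_sq, hx, real_inner_comm]
  ring

/-- The density turns into a multiple of `exp (-x² / 4)`. The value `√2` leaves room below `2` for
the factor `exp (1/4)` due to the identity matrix in `gramEntry`. -/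
lemma integrable_exp_sq_div_four_gaussianReal :
    Integrable (fun x => Real.exp (x ^ 2 / 4)) (gaussianReal 0 1) ∧
      ∫ x, Real.exp (x ^ 2 / 4) ∂gaussianReal 0 1 = √2 := by
  have e : ∀ x, gaussianPDFReal 0 1 x * Real.exp (x ^ 2 / 4) =
      (√(2 * Real.pi))⁻¹ * Real.exp (-(1 / 4) * x ^ 2) := by
    intro x
    simp only [gaussianPDFReal, NNReal.coe_one, mul_one, sub_zero]
    rw [mul_assoc, ← Real.exp_add]; congr 2; ring
  constructor
  · rw [gaussianReal_of_var_ne_zero _ one_ne_zero,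
      integrable_withDensity_iff_integrable_smul' (by fun_prop)
        (.of_forall fun _ => gaussianPDF_lt_top)]
    simp only [toReal_gaussianPDF, smul_eq_mul, e]
    exact (integrable_exp_neg_mul_sq (by norm_num)).const_mul _
  · rw [integral_gaussianReal_eq_integral_smul one_ne_zero]
    simp only [smul_eq_mul, e]
    rw [integral_const_mul, integral_gaussian, ← Real.sqrt_inv, ← Real.sqrt_mul (by positivity)]
    congr 1
    field_simp
    norm_num

/-- The entry `a j * a k - δ j k` of `a aᵀ - I`. -/
noncomputable def gramEntry (j k : Fin n) (a : EuclideanSpace ℝ (Fin n)) : ℝ :=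
  a j * a k - (1 : Matrix (Fin n) (Fin n) ℝ) j k

lemma measurable_gramEntry (j k : Fin n) : Measurable (gramEntry j k) := by
  unfold gramEntry; fun_prop

lemma hasLaw_apply_stdGaussian (j : Fin n) :
    HasLaw (fun a : EuclideanSpace ℝ (Fin n) => a j) (gaussianReal 0 1)
      (stdGaussian (EuclideanSpace ℝ (Fin n))) := by
  have h := hasLaw_inner_stdGaussian (u := EuclideanSpace.single j (1 : ℝ)) (by simp)
  simpa [EuclideanSpace.inner_single_left] using h

lemma exp_abs_gramEntry_le (j k : Fin n) (a : EuclideanSpace ℝ (Fin n)) :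
    Real.exp (|gramEntry j k a| / 4) ≤
      Real.exp (1 / 4) * ((Real.exp (a j ^ 2 / 4) + Real.exp (a k ^ 2 / 4)) / 2) := by
  have h1 : |gramEntry j k a| ≤ (a j ^ 2 + a k ^ 2) / 2 + 1 := by
    have hd : |(1 : Matrix (Fin n) (Fin n) ℝ) j k| ≤ 1 := by
      rw [Matrix.one_apply]; split_ifs <;> simp
    have hp : |a j * a k| ≤ (a j ^ 2 + a k ^ 2) / 2 := by
      rw [abs_mul]; nlinarith [sq_nonneg (|a j| - |a k|), sq_abs (a j), sq_abs (a k)]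
    exact (abs_sub _ _).trans (add_le_add hp hd)
  have h2 : Real.exp (a j ^ 2 / 4) = Real.exp (a j ^ 2 / 8) ^ 2 := by
    rw [← Real.exp_nat_mul]; congr 1; push_cast; ring
  have h3 : Real.exp (a k ^ 2 / 4) = Real.exp (a k ^ 2 / 8) ^ 2 := by
    rw [← Real.exp_nat_mul]; congr 1; push_cast; ring
  calc Real.exp (|gramEntry j k a| / 4)
      ≤ Real.exp (1 / 4 + (a j ^ 2 / 8 + a k ^ 2 / 8)) := Real.exp_le_exp.2 (by linarith)
    _ = Real.exp (1 / 4) * (Real.exp (a j ^ 2 / 8) * Real.exp (a k ^ 2 / 8)) := by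
        rw [Real.exp_add, Real.exp_add]
    _ ≤ _ := by
        gcongr
        rw [h2, h3]
        nlinarith [sq_nonneg (Real.exp (a j ^ 2 / 8) - Real.exp (a k ^ 2 / 8))]

lemma integrable_exp_abs_gramEntry (j k : Fin n) :
    Integrable (fun a => Real.exp (|gramEntry j k a| / 4))
        (stdGaussian (EuclideanSpace ℝ (Fin n))) ∧
      ∫ a, Real.exp (|gramEntry j k a| / 4) ∂stdGaussian (EuclideanSpace ℝ (Fin n)) ≤ 2 := by
  have hmeas : AEStronglyMeasurable (fun x : ℝ => Real.exp (x ^ 2 / 4)) (gaussianReal 0 1) := by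
    fun_prop
  have hI : ∀ i : Fin n, Integrable (fun a : EuclideanSpace ℝ (Fin n) => Real.exp (a i ^ 2 / 4))
      (stdGaussian (EuclideanSpace ℝ (Fin n))) := fun i => by
    have h := integrable_exp_sq_div_four_gaussianReal.1
    rw [← (hasLaw_apply_stdGaussian i).map_eq] at h
    exact h.comp_aemeasurable (hasLaw_apply_stdGaussian i).aemeasurable
  have hE : ∀ i : Fin n, ∫ a : EuclideanSpace ℝ (Fin n), Real.exp (a i ^ 2 / 4)
      ∂stdGaussian (EuclideanSpace ℝ (Fin n)) = √2 := fun i => by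
    rw [← integrable_exp_sq_div_four_gaussianReal.2]
    exact (hasLaw_apply_stdGaussian i).integral_comp hmeas
  have hmaj := (((hI j).add (hI k)).div_const 2).const_mul (Real.exp (1 / 4))
  have hint : Integrable (fun a => Real.exp (|gramEntry j k a| / 4))
      (stdGaussian (EuclideanSpace ℝ (Fin n))) := by
    refine hmaj.mono' ?_ (.of_forall fun a => ?_)
    · exact ((measurable_gramEntry j k).abs.div_const 4).exp.aestronglyMeasurable
    · rw [Real.norm_of_nonneg (Real.exp_nonneg _)]
      exact exp_abs_gramEntry_le j k a
  refine ⟨hint, (integral_mono hint hmaj fun a => exp_abs_gramEntry_le j k a).trans ?_⟩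
  simp only [Pi.add_apply]
  rw [integral_const_mul, integral_div, integral_add (hI j) (hI k), hE, hE]
  have h4 : Real.exp (1 / 4) ≤ √2 := by
    refine Real.le_sqrt_of_sq_le ?_
    rw [← Real.exp_nat_mul]
    have h5 : Real.exp ((2 : ℕ) * (1 / 4)) ^ 2 = Real.exp 1 := by
      rw [← Real.exp_nat_mul]; congr 1; norm_num
    nlinarith [Real.exp_one_lt_d9, Real.exp_pos ((2 : ℕ) * (1 / 4))]
  nlinarith [Real.sq_sqrt (show (0 : ℝ) ≤ 2 by norm_num), Real.sqrt_nonneg 2]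

end GaussianVector

/-- A bound on the `ψ₁` norm bounds the exponential moment at every larger scale. -/
lemma integrable_exp_of_psiOneNorm_le {Ω : Type*} [MeasurableSpace Ω] {P : Measure Ω}
    [IsProbabilityMeasure P] {X : Ω → ℝ} (hX : Measurable X) {K : ℝ≥0} (hK : psiOneNorm X P ≤ K)
    {κ : ℝ≥0} (hκ : K < κ) :
    Integrable (fun ω => Real.exp (|X ω| / κ)) P ∧ ∫ ω, Real.exp (|X ω| / κ) ∂P ≤ 2 := by
  -- Strict inequality provides an admissible scale `t < κ` even if the infimum is not attained.
  have hlt : psiOneNorm X P < κ := hK.trans_lt (by exact_mod_cast hκ)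
  simp only [psiOneNorm, orliczNorm, iInf_lt_iff, Set.mem_ofPred_eq, ENNReal.coe_lt_coe] at hlt
  obtain ⟨t, ⟨ht0, ht⟩, htκ⟩ := hlt
  have hmeas : Measurable fun ω => Real.exp (|X ω| / κ) := by fun_prop
  have hle : ∫⁻ ω, ENNReal.ofReal (Real.exp (|X ω| / κ)) ∂P ≤ 2 := by
    calc ∫⁻ ω, ENNReal.ofReal (Real.exp (|X ω| / κ)) ∂P
        ≤ ∫⁻ ω, (ENNReal.ofReal (Real.exp (|X ω| / t) - 1) + 1) ∂P := by
          refine lintegral_mono fun ω => ?_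
          have h0 : (0 : ℝ) < t := by exact_mod_cast ht0
          have h1 : Real.exp (|X ω| / κ) ≤ Real.exp (|X ω| / t) := by
            refine Real.exp_le_exp.2 ?_
            gcongr
          rw [← ENNReal.ofReal_one, ← ENNReal.ofReal_add _ zero_le_one]
          · exact ENNReal.ofReal_le_ofReal (by linarith)
          · have := Real.one_le_exp (show 0 ≤ |X ω| / t by positivity)
            linarith
      _ = ∫⁻ ω, ENNReal.ofReal (Real.exp (|X ω| / t) - 1) ∂P + 1 := by
          rw [lintegral_add_right _ measurable_const]; simp
      _ ≤ 1 + 1 := by gcongr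
      _ = 2 := by norm_num
  have hint : Integrable (fun ω => Real.exp (|X ω| / κ)) P := by
    refine ⟨hmeas.aestronglyMeasurable, ?_⟩
    rw [hasFiniteIntegral_iff_ofReal (.of_forall fun _ => Real.exp_nonneg _)]
    exact hle.trans_lt (by simp)
  refine ⟨hint, ?_⟩
  rw [integral_eq_lintegral_of_nonneg_ae (.of_forall fun _ => Real.exp_nonneg _)
    hmeas.aestronglyMeasurable]
  exact ENNReal.toReal_le_of_le_ofReal (by norm_num) (by simpa using hle)

lemma memLp_two_of_integrable_exp {Ω : Type*} [MeasurableSpace Ω] {P : Measure Ω} {X : Ω → ℝ}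
    (hX : Measurable X) {κ : ℝ} (hκ : 0 < κ)
    (h : Integrable (fun ω => Real.exp (|X ω| / κ)) P) : MemLp X 2 P := by
  rw [memLp_two_iff_integrable_sq hX.aestronglyMeasurable]
  refine (h.const_mul (4 * κ ^ 2)).mono' (hX.pow_const 2).aestronglyMeasurable
    (.of_forall fun ω => ?_)
  have h1 : |X ω| ≤ 2 * κ * Real.exp (|X ω| / (2 * κ)) := le_mul_exp_div (by positivity)
  have e1 : Real.exp (|X ω| / κ) = Real.exp (|X ω| / (2 * κ)) ^ 2 := by
    rw [← Real.exp_nat_mul]; congr 1; field_simp; push_cast; ring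
  rw [Real.norm_eq_abs, abs_pow]
  calc |X ω| ^ 2 ≤ (2 * κ * Real.exp (|X ω| / (2 * κ))) ^ 2 := by gcongr
    _ = 4 * κ ^ 2 * Real.exp (|X ω| / κ) := by rw [e1]; ring

section Link

variable {n : ℕ} {Ξ : Type*} [MeasurableSpace Ξ] {ν : Measure Ξ} [IsProbabilityMeasure ν]

lemma hasLaw_inner_prod {x : EuclideanSpace ℝ (Fin n)} (hx : ‖x‖ = 1) :
    HasLaw (fun p : EuclideanSpace ℝ (Fin n) × Ξ => (inner ℝ x p.1, p.2))
      ((gaussianReal 0 1).prod ν) ((stdGaussian (EuclideanSpace ℝ (Fin n))).prod ν) := by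
  refine ⟨by fun_prop, ?_⟩
  have h := Measure.map_prod_map (stdGaussian (EuclideanSpace ℝ (Fin n))) ν
    (f := fun a => inner ℝ x a) (g := id) (by fun_prop) measurable_id
  rw [(hasLaw_inner_stdGaussian hx).map_eq, Measure.map_id] at h
  exact h.symm

/-- A function of the component along `x` and of the noise is uncorrelated with every function of
the component orthogonal to `x`. -/
lemma integral_mul_orthogonal {x : EuclideanSpace ℝ (Fin n)} (hx : ‖x‖ = 1) {F : ℝ → Ξ → ℝ}
    (hF : Measurable (Function.uncurry F)) {H : EuclideanSpace ℝ (Fin n) → ℝ} (hH : Measurable H)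
    (hFi : Integrable (fun p => F (inner ℝ x p.1) p.2)
      ((stdGaussian (EuclideanSpace ℝ (Fin n))).prod ν))
    (hFH : Integrable (fun p => F (inner ℝ x p.1) p.2 * H (p.1 - inner ℝ x p.1 • x))
      ((stdGaussian (EuclideanSpace ℝ (Fin n))).prod ν)) :
    ∫ p, F (inner ℝ x p.1) p.2 * H (p.1 - inner ℝ x p.1 • x)
        ∂((stdGaussian (EuclideanSpace ℝ (Fin n))).prod ν) =
      (∫ p, F (inner ℝ x p.1) p.2 ∂((stdGaussian (EuclideanSpace ℝ (Fin n))).prod ν)) *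
        ∫ a, H (a - inner ℝ x a • x) ∂stdGaussian (EuclideanSpace ℝ (Fin n)) := by
  -- Fixing the noise `ξ` first reduces the claim to independence under the Gaussian measure alone.
  rw [integral_prod_symm _ hFH, integral_prod_symm _ hFi, ← integral_mul_const]
  refine integral_congr_ae (.of_forall fun ξ => ?_)
  have hFξ : Measurable fun u => F u ξ := hF.comp (by fun_prop : Measurable fun u : ℝ => (u, ξ))
  have hind := (indepFun_inner_sub_smul hx).comp hFξ hH
  exact hind.integral_mul_eq_mul_integral
    (hFξ.comp (by fun_prop : Measurable fun a => inner ℝ x a)).aestronglyMeasurable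
    (hH.comp (by fun_prop : Measurable fun a : EuclideanSpace ℝ (Fin n) =>
      a - inner ℝ x a • x)).aestronglyMeasurable

lemma memLp_two_inner_mul_inner (u w : EuclideanSpace ℝ (Fin n)) :
    MemLp (fun p : EuclideanSpace ℝ (Fin n) × Ξ => inner ℝ u p.1 * inner ℝ w p.1) 2
      ((stdGaussian (EuclideanSpace ℝ (Fin n))).prod ν) := by
  have : ENNReal.HolderTriple 4 4 2 := ⟨by
    rw [← ENNReal.toReal_eq_toReal_iff' (by simp) (by simp),
      ENNReal.toReal_add (by simp) (by simp)]
    norm_num⟩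
  have h : MemLp (fun a => inner ℝ u a * inner ℝ w a) 2
      (stdGaussian (EuclideanSpace ℝ (Fin n))) :=
    (memLp_inner_stdGaussian w (p := 4) (by simp)).mul
      (memLp_inner_stdGaussian u (p := 4) (by simp))
  exact h.comp_fst ν

/-- The population version of the reweighted covariance matrix is `Cov(g², f(g)) • x xᵀ`. -/
lemma integral_link_mul_gramEntry {x : EuclideanSpace ℝ (Fin n)} (hx : ‖x‖ = 1) {f : ℝ → Ξ → ℝ}
    (hf : Measurable (Function.uncurry f))
    (hf2 : MemLp (Function.uncurry f) 2 ((gaussianReal 0 1).prod ν)) (j k : Fin n) :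
    ∫ p, f (inner ℝ x p.1) p.2 * gramEntry j k p.1
        ∂((stdGaussian (EuclideanSpace ℝ (Fin n))).prod ν) = linkCov f ν * (x j * x k) := by
  set Q := (stdGaussian (EuclideanSpace ℝ (Fin n))).prod ν with hQ
  have hlaw := hasLaw_inner_prod (ν := ν) hx
  set y : EuclideanSpace ℝ (Fin n) × Ξ → ℝ := fun p => f (inner ℝ x p.1) p.2 with hy
  set g : EuclideanSpace ℝ (Fin n) × Ξ → ℝ := fun p => inner ℝ x p.1 with hg
  have hy2 : MemLp y 2 Q := by
    have h := hf2
    rw [← hlaw.map_eq] at h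
    exact h.comp_of_map hlaw.aemeasurable
  -- `e i` projects the basis vector to `x^⊥`, so that `a i = x i * g + ⟨e i, a⟩` with the last term
  -- independent of `g`.
  let e : Fin n → EuclideanSpace ℝ (Fin n) := fun i => EuclideanSpace.single i (1 : ℝ) - x i • x
  have hee : ∀ i (a : EuclideanSpace ℝ (Fin n)), inner ℝ (e i) a = (a - inner ℝ x a • x) i := by
    intro i a
    simp only [e, inner_sub_left, real_inner_smul_left, EuclideanSpace.inner_single_left, map_one,
      one_mul, PiLp.sub_apply, PiLp.smul_apply, smul_eq_mul]
    ring
  have hyi : Integrable y Q := hy2.integrable (by norm_num)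
  have hymul : ∀ u w : EuclideanSpace ℝ (Fin n),
      Integrable (fun p => y p * (inner ℝ u p.1 * inner ℝ w p.1)) Q := fun u w =>
    hy2.integrable_mul (memLp_two_inner_mul_inner u w)
  have hyg : Integrable (fun p => y p * g p) Q := by
    have h1 : MemLp g 2 Q :=
      (memLp_inner_stdGaussian x (p := 2) (by simp)).comp_fst ν
    exact hy2.integrable_mul h1
  have hmid : ∀ i, ∫ p, y p * (g p * inner ℝ (e i) p.1) ∂Q = 0 := by
    intro i
    have h := integral_mul_orthogonal (ν := ν) hx (F := fun u ξ => f u ξ * u)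
      (H := fun b => b i) (hf.mul measurable_fst) (by fun_prop) hyg (by
        simpa only [hee, mul_assoc] using hymul x (e i))
    simp only [← hee] at h
    rw [integral_inner_stdGaussian, mul_zero] at h
    simpa only [mul_assoc] using h
  have hlast : ∫ p, y p * (inner ℝ (e j) p.1 * inner ℝ (e k) p.1) ∂Q =
      (∫ p, y p ∂Q) * inner ℝ (e j) (e k) := by
    have h := integral_mul_orthogonal (ν := ν) hx (F := f)
      (H := fun b => b j * b k) hf (by fun_prop) hyi (by
        simpa only [hee] using hymul (e j) (e k))
    simp only [← hee] at h
    rw [integral_inner_mul_inner_stdGaussian] at h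
    exact h
  have hej : inner ℝ (e j) (e k) = (1 : Matrix (Fin n) (Fin n) ℝ) j k - x j * x k := by
    rw [hee]
    simp only [e, inner_sub_right, real_inner_smul_right, real_inner_self_eq_norm_sq, hx,
      EuclideanSpace.inner_single_right, PiLp.sub_apply, PiLp.smul_apply, smul_eq_mul,
      Matrix.one_apply, PiLp.single_apply]
    simp
    ring
  have hcov : linkCov f ν = ∫ p, y p * (g p * g p) ∂Q - ∫ p, y p ∂Q := by
    have h1 := hlaw.covariance_fun_comp (f := fun q : ℝ × Ξ => q.1 ^ 2)
      (g := fun q : ℝ × Ξ => f q.1 q.2) (by fun_prop) hf.aemeasurable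
    have hg2 : MemLp (fun p => g p ^ 2) 2 Q := by
      simpa only [sq] using memLp_two_inner_mul_inner (ν := ν) x x
    have hone : ∫ p, g p ^ 2 ∂Q = 1 := by
      have h3 := integral_inner_mul_inner_stdGaussian x x
      rw [real_inner_self_eq_norm_sq, hx, one_pow] at h3
      have h4 := integral_fun_fst (μ := stdGaussian (EuclideanSpace ℝ (Fin n))) (ν := ν)
        (fun a => inner ℝ x a * inner ℝ x a)
      rw [h3] at h4
      simpa [sq] using h4
    rw [linkCov, ← h1, covariance_eq_sub hg2 hy2, hone, one_mul]
    congr 1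
    refine integral_congr_ae (.of_forall fun p => ?_)
    simp only [Pi.mul_apply]
    ring
  -- After integration the two cross terms vanish, and `⟨e j, e k⟩ = δ j k - x j * x k` leaves `x j
  -- * x k * (𝔼 y g² - 𝔼 y)`.
  have hpt : ∀ p : EuclideanSpace ℝ (Fin n) × Ξ, y p * gramEntry j k p.1 =
      x j * x k * (y p * (g p * g p)) + x j * (y p * (g p * inner ℝ (e k) p.1)) +
        x k * (y p * (g p * inner ℝ (e j) p.1)) +
        y p * (inner ℝ (e j) p.1 * inner ℝ (e k) p.1) -
        (1 : Matrix (Fin n) (Fin n) ℝ) j k * y p := by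
    intro p
    simp only [gramEntry, hee, PiLp.sub_apply, PiLp.smul_apply, smul_eq_mul, hg]
    ring
  have i1 := (hymul x x).const_mul (x j * x k)
  have i2 := (hymul x (e k)).const_mul (x j)
  have i3 := (hymul x (e j)).const_mul (x k)
  have i4 := hymul (e j) (e k)
  have i5 := hyi.const_mul ((1 : Matrix (Fin n) (Fin n) ℝ) j k)
  refine (integral_congr_ae (.of_forall hpt)).trans ?_
  rw [integral_sub (((i1.fun_add i2).fun_add i3).fun_add i4) i5,
    integral_add ((i1.fun_add i2).fun_add i3) i4, integral_add (i1.fun_add i2) i3,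
    integral_add i1 i2, integral_const_mul, integral_const_mul, integral_const_mul,
    integral_const_mul, hmid, hmid, hlast, hej, hcov]
  ring

end Link

end MPR

/-! ### Uniform concentration, choice of parameters and conclusion. -/

namespace MPR

/-- Uniform concentration of the centered truncated entries of the reweighted covariance matrix. -/
lemma measureReal_bad_le {n m : ℕ} {Ω Ξ : Type*} [MeasurableSpace Ω] [MeasurableSpace Ξ]
    {P : Measure Ω} [IsProbabilityMeasure P] {ν : Measure Ξ} [IsProbabilityMeasure ν]
    {Z : Fin m → Ω → EuclideanSpace ℝ (Fin n) × Ξ} (hind : iIndepFun Z P)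
    (hlaw : ∀ i, HasLaw (Z i) ((stdGaussian (EuclideanSpace ℝ (Fin n))).prod ν) P)
    {y : EuclideanSpace ℝ (Fin n) × Ξ → ℝ} (hym : Measurable y) {κ : ℝ} (hκ : 0 < κ)
    (hyi : Integrable (fun p => Real.exp (|y p| / κ))
      ((stdGaussian (EuclideanSpace ℝ (Fin n))).prod ν))
    (hy : ∫ p, Real.exp (|y p| / κ) ∂((stdGaussian (EuclideanSpace ℝ (Fin n))).prod ν) ≤ 2)
    {T r : ℝ} (hr : 0 ≤ r) (hrT : r * T ≤ 1 / 16) (u : ℝ) :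
    P.real {ω | (∃ i, T < |y (Z i ω)|) ∨ ∃ j k, u ≤
        |∑ i, (truncMul y (fun p => gramEntry j k p.1) T (Z i ω) -
          ∫ q, truncMul y (fun p => gramEntry j k p.1) T q
            ∂((stdGaussian (EuclideanSpace ℝ (Fin n))).prod ν))|} ≤
      m * (2 * Real.exp (-(T / κ))) +
        n ^ 2 * (2 * Real.exp (-(r * u) + m * (32768 * κ ^ 2 * r ^ 2))) := by
  set Q := (stdGaussian (EuclideanSpace ℝ (Fin n))).prod ν with hQ
  set U : Fin n → Fin n → EuclideanSpace ℝ (Fin n) × Ξ → ℝ := fun j k p =>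
    truncMul y (fun p => gramEntry j k p.1) T p -
      ∫ q, truncMul y (fun p => gramEntry j k p.1) T q ∂Q with hU
  have hWm : ∀ j k : Fin n,
      Measurable fun p : EuclideanSpace ℝ (Fin n) × Ξ => gramEntry j k p.1 := fun j k =>
    (measurable_gramEntry j k).comp measurable_fst
  have hWi : ∀ j k : Fin n, Integrable (fun p : EuclideanSpace ℝ (Fin n) × Ξ =>
      Real.exp (|gramEntry j k p.1| / 4)) Q := fun j k =>
    (integrable_exp_abs_gramEntry j k).1.comp_fst ν
  have hW : ∀ j k : Fin n, ∫ p : EuclideanSpace ℝ (Fin n) × Ξ,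
      Real.exp (|gramEntry j k p.1| / 4) ∂Q ≤ 2 := fun j k => by
    have h := integral_fun_fst (μ := stdGaussian (EuclideanSpace ℝ (Fin n))) (ν := ν)
      (fun a => Real.exp (|gramEntry j k a| / 4))
    rw [h]
    simpa using (integrable_exp_abs_gramEntry j k).2
  have hUm : ∀ j k, Measurable (U j k) := fun j k =>
    (measurable_truncMul hym (hWm j k) T).sub_const _
  have hpos : ∀ j k, P.real {ω | u ≤ ∑ i, U j k (Z i ω)} ≤
      Real.exp (-(r * u) + m * (32768 * κ ^ 2 * r ^ 2)) := fun j k => by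
    have h := mgf_truncMul_le hκ hym (hWm j k) hyi (hWi j k) hy (hW j k)
      (T := T) (r := r) (by rwa [abs_of_nonneg hr])
    exact measureReal_le_sum_le hind hlaw (hUm j k) hr h.1 h.2 u
  have hneg : ∀ j k, P.real {ω | u ≤ ∑ i, -U j k (Z i ω)} ≤
      Real.exp (-(r * u) + m * (32768 * κ ^ 2 * r ^ 2)) := fun j k => by
    have h := mgf_truncMul_le hκ hym (hWm j k) hyi (hWi j k) hy (hW j k)
      (T := T) (r := -r) (by rwa [abs_neg, abs_of_nonneg hr])
    refine measureReal_le_sum_le hind hlaw (U := fun p => -U j k p) (hUm j k).neg hr ?_ ?_ u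
    · simpa [neg_mul, mul_neg] using h.1
    · have h2 := h.2
      rw [neg_sq] at h2
      refine le_trans (le_of_eq ?_) h2
      simp only [mgf, neg_mul, mul_neg, hU]
  have hmax : ∀ i, P.real {ω | T < |y (Z i ω)|} ≤ 2 * Real.exp (-(T / κ)) := fun i => by
    rw [(hlaw i).measureReal_eq (p := fun p => T < |y p|)
      (measurableSet_lt measurable_const hym.abs)]
    exact measureReal_lt_abs_le hκ hyi hy T
  have hsub : {ω | (∃ i, T < |y (Z i ω)|) ∨ ∃ j k, u ≤ |∑ i, U j k (Z i ω)|} ⊆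
      (⋃ i, {ω | T < |y (Z i ω)|}) ∪ ⋃ q : Fin n × Fin n,
        ({ω | u ≤ ∑ i, U q.1 q.2 (Z i ω)} ∪ {ω | u ≤ ∑ i, -U q.1 q.2 (Z i ω)}) := by
    rintro ω (⟨i, hi⟩ | ⟨j, k, h⟩)
    · exact Or.inl (Set.mem_iUnion.2 ⟨i, hi⟩)
    · refine Or.inr (Set.mem_iUnion.2 ⟨(j, k), ?_⟩)
      rcases le_abs.1 h with h | h
      · exact Or.inl h
      · refine Or.inr ?_
        change u ≤ ∑ i, -U j k (Z i ω)
        rwa [Finset.sum_neg_distrib]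
  refine (measureReal_mono hsub).trans ((measureReal_union_le _ _).trans (add_le_add ?_ ?_))
  · refine (measureReal_iUnion_fintype_le _).trans ?_
    refine (Finset.sum_le_sum fun i _ => hmax i).trans (le_of_eq ?_)
    simp
  · refine (measureReal_iUnion_fintype_le _).trans ?_
    refine (Finset.sum_le_sum fun q _ => (measureReal_union_le _ _).trans
      (add_le_add (hpos q.1 q.2) (hneg q.1 q.2))).trans (le_of_eq ?_)
    simp
    ring

/-- The sample size makes the concentration bounds effective, for a suitable Chernoff parameter. -/
lemma exists_chernoff_parameter {n m s : ℕ} (hn : 2 ≤ n) (hs : 1 ≤ s) {κ μ ε δ : ℝ} (hκ : 1 ≤ κ)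
    (hμ : 0 < μ) (hε : 0 < ε) (hδ : 0 < δ) (hδ1 : δ < 1)
    (hm : 10 ^ 9 * κ ^ 2 * max ((s : ℝ) ^ 2 * (Real.log (n / δ) + Real.log (s / δ) ^ 4) /
      (μ ^ 2 * ε ^ 4)) (max (s / δ) (Real.log (n / δ) * Real.log m ^ 2)) ≤ m) :
    2 ≤ m ∧ ∃ r : ℝ, 0 ≤ r ∧ r * (4 * κ * Real.log m) ≤ 1 / 16 ∧
      m * (2 * Real.exp (-(4 * κ * Real.log m / κ))) + n ^ 2 * (2 * Real.exp
        (-(r * (m * (μ * ε ^ 2 / (8 * s)) / 2)) + m * (32768 * κ ^ 2 * r ^ 2))) ≤ δ ∧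
      64 * κ * Real.exp (-(4 * κ * Real.log m / (4 * κ))) ≤ μ * ε ^ 2 / (8 * s) / 2 := by
  have hκ0 : 0 < κ := by linarith
  have hs1 : (1 : ℝ) ≤ s := by exact_mod_cast hs
  have hs0 : (0 : ℝ) < s := by linarith
  have hn2 : (2 : ℝ) ≤ n := by exact_mod_cast hn
  have hC : (0 : ℝ) ≤ 10 ^ 9 * κ ^ 2 := by positivity
  set L := Real.log (n / δ) with hL
  set t := μ * ε ^ 2 / (8 * s) with ht
  have ht0 : 0 < t := by positivity
  have hLhalf : 1 / 2 ≤ L := by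
    have h2 : (2 : ℝ) ≤ n / δ := by rw [le_div_iff₀ hδ]; nlinarith
    have := Real.log_le_log (by norm_num) h2
    linarith [Real.log_two_gt_d9]
  have hA : 10 ^ 9 * κ ^ 2 * L ≤ 64 * (m * t ^ 2) := by
    have h1 := (mul_le_mul_of_nonneg_left (le_max_left _ _) hC).trans hm
    rw [mul_div_assoc', div_le_iff₀ (by positivity)] at h1
    have e : 64 * (m * t ^ 2) = m * (μ ^ 2 * ε ^ 4) / s ^ 2 := by rw [ht]; field_simp; ring
    rw [e, le_div_iff₀ (by positivity)]
    refine le_trans ?_ h1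
    have h4 : 0 ≤ Real.log (s / δ) ^ 4 := by positivity
    calc 10 ^ 9 * κ ^ 2 * L * s ^ 2 = 10 ^ 9 * κ ^ 2 * (s ^ 2 * (L + 0)) := by ring
      _ ≤ _ := by gcongr
  have hB : 10 ^ 9 * κ ^ 2 ≤ m * δ := by
    have h1 := (mul_le_mul_of_nonneg_left ((le_max_left _ _).trans (le_max_right _ _)) hC).trans hm
    rw [mul_div_assoc', div_le_iff₀ hδ] at h1
    exact (le_mul_of_one_le_right hC hs1).trans h1
  have hD : 10 ^ 9 * κ ^ 2 * (L * Real.log m ^ 2) ≤ m :=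
    (mul_le_mul_of_nonneg_left ((le_max_right _ _).trans (le_max_right _ _)) hC).trans hm
  have hκ2 : 1 ≤ κ ^ 2 := one_le_pow₀ hκ
  have hmC : 10 ^ 9 * κ ^ 2 ≤ m := by
    refine hB.trans (mul_le_of_le_one_right (by positivity) hδ1.le)
  have hm2 : (2 : ℝ) ≤ m := by linarith
  have hm0 : (0 : ℝ) < m := by linarith
  set ℓ := Real.log m with hℓ
  have hℓ0 : 0 < ℓ := Real.log_pos (by linarith)
  -- The first term minimizes the Chernoff exponent `-(r t / 2) + 32768 κ² r²`; the second is the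
  -- cap `r T ≤ 1/16` imposed by truncation.
  refine ⟨by exact_mod_cast hm2, min (t / (131072 * κ ^ 2)) (1 / (64 * κ * ℓ)),
    le_min (by positivity) (by positivity), ?_, ?_, ?_⟩
  · calc min (t / (131072 * κ ^ 2)) (1 / (64 * κ * ℓ)) * (4 * κ * ℓ)
        ≤ 1 / (64 * κ * ℓ) * (4 * κ * ℓ) := by gcongr; exact min_le_right _ _
      _ = 1 / 16 := by field_simp; norm_num
  · set r := min (t / (131072 * κ ^ 2)) (1 / (64 * κ * ℓ)) with hr
    have hr0 : 0 ≤ r := le_min (by positivity) (by positivity)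
    have hrt : 131072 * κ ^ 2 * r ≤ t := by
      have := min_le_left (t / (131072 * κ ^ 2)) (1 / (64 * κ * ℓ))
      rw [← hr, le_div_iff₀ (by positivity)] at this
      linarith
    -- As `T / κ = 4 log m`, each sample is truncated with probability at most `2 m⁻⁴`.
    have hfirst : m * (2 * Real.exp (-(4 * κ * ℓ / κ))) ≤ δ / 2 := by
      have e : Real.exp (-(4 * κ * ℓ / κ)) = ((m : ℝ) ^ 4)⁻¹ := by
        have : 4 * κ * ℓ / κ = (4 : ℕ) * ℓ := by field_simp; norm_num
        rw [this, Real.exp_neg, Real.exp_nat_mul, hℓ, Real.exp_log hm0]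
      rw [e, ← div_eq_mul_inv, mul_div_assoc', div_le_iff₀ (by positivity)]
      have h4 : 4 ≤ m * δ := by linarith
      have h5 : 1 ≤ (m : ℝ) ^ 2 := one_le_pow₀ (by linarith)
      have h6 : (m : ℝ) * 4 ≤ m ^ 3 * (m * δ) := by
        calc (m : ℝ) * 4 ≤ m * (m ^ 2 * (m * δ)) := by
              gcongr
              exact h4.trans (le_mul_of_one_le_left (by positivity) h5)
          _ = _ := by ring
      linarith
    have hrmt : 16 * L ≤ r * (m * t) := by
      rcases min_choice (t / (131072 * κ ^ 2)) (1 / (64 * κ * ℓ)) with h | h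
      · rw [hr, h, div_mul_eq_mul_div, le_div_iff₀ (by positivity)]
        have : 0 ≤ κ ^ 2 * L := by positivity
        linarith
      · rw [hr, h, div_mul_eq_mul_div, le_div_iff₀ (by positivity), one_mul]
        -- When the cap is active, write `(m t)² = (m t²) * m` and bound the factors by `hA` and
        -- `hD`.
        refine abs_le_of_sq_le_sq' ?_ (by positivity) |>.2
        have hL0 : 0 ≤ L := by linarith
        calc (16 * L * (64 * κ * ℓ)) ^ 2
            = (1048576 * L) * (κ ^ 2 * (L * ℓ ^ 2)) := by ring
          _ ≤ (10 ^ 9 * κ ^ 2 * L / 64) * (10 ^ 9 * κ ^ 2 * (L * ℓ ^ 2)) := by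
              have h1 : 1048576 * L ≤ 10 ^ 9 * κ ^ 2 * L / 64 := by
                linarith [mul_le_mul_of_nonneg_right hκ2 hL0]
              have h2 : κ ^ 2 * (L * ℓ ^ 2) ≤ 10 ^ 9 * κ ^ 2 * (L * ℓ ^ 2) := by
                have : 0 ≤ κ ^ 2 * (L * ℓ ^ 2) := by positivity
                linarith
              exact mul_le_mul h1 h2 (by positivity) (by positivity)
          _ ≤ (m * t ^ 2) * m := by
              gcongr
              linarith
          _ = (m * t) ^ 2 := by ring
    -- By `hrt` the quadratic term is at most half the linear one, leaving `-(r m t) / 4 ≤ -(4 L)`.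
    have hexp : -(r * (m * t / 2)) + m * (32768 * κ ^ 2 * r ^ 2) ≤ -(4 * L) := by
      have h1 : m * r * (131072 * κ ^ 2 * r) ≤ m * r * t := by gcongr
      linarith
    have hsecond : n ^ 2 * (2 * Real.exp
        (-(r * (m * t / 2)) + m * (32768 * κ ^ 2 * r ^ 2))) ≤ δ / 2 := by
      have e : Real.exp (-(4 * L)) = δ ^ 4 / n ^ 4 := by
        have : 4 * L = (4 : ℕ) * L := by norm_num
        rw [this, Real.exp_neg, Real.exp_nat_mul, hL, Real.exp_log (by positivity), div_pow,
          inv_div]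
      calc n ^ 2 * (2 * Real.exp (-(r * (m * t / 2)) + m * (32768 * κ ^ 2 * r ^ 2)))
          ≤ n ^ 2 * (2 * Real.exp (-(4 * L))) := by gcongr
        _ = 2 * δ ^ 4 / n ^ 2 := by rw [e]; field_simp
        _ ≤ δ / 2 := by
            rw [div_le_iff₀ (by positivity)]
            have h1 : δ ^ 4 ≤ δ := pow_le_of_le_one hδ.le hδ1.le (by norm_num)
            have h2 : (4 : ℝ) ≤ n ^ 2 := by
              calc (4 : ℝ) = 2 ^ 2 := by norm_num
                _ ≤ n ^ 2 := by gcongr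
            linarith [mul_le_mul_of_nonneg_left h2 hδ.le]
    linarith
  · have e : Real.exp (-(4 * κ * ℓ / (4 * κ))) = (m : ℝ)⁻¹ := by
      rw [mul_div_cancel_left₀ _ (by positivity), Real.exp_neg, hℓ, Real.exp_log hm0]
    rw [e, ← div_eq_mul_inv, div_le_iff₀ hm0]
    -- The bias is at most `64 κ / m`; again `(m t)² = (m t²) * m`, now with `m ≥ 10⁹ κ²`.
    have h1 : 128 * κ ≤ m * t := by
      refine abs_le_of_sq_le_sq' ?_ (by positivity) |>.2
      calc (128 * κ) ^ 2 = 16384 * κ ^ 2 := by ring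
        _ ≤ (10 ^ 9 * κ ^ 2 * L / 64) * (10 ^ 9 * κ ^ 2) := by
            have h2 : 16384 ≤ 10 ^ 9 * κ ^ 2 * L / 64 := by
              linarith [mul_le_mul hκ2 hLhalf (by norm_num) (by positivity)]
            have h3 : κ ^ 2 ≤ 10 ^ 9 * κ ^ 2 := by linarith
            exact mul_le_mul h2 h3 (by positivity) (by positivity)
        _ ≤ (m * t ^ 2) * m := by
            gcongr
            linarith
        _ = (m * t) ^ 2 := by ring
    linarith

lemma sampleCov_apply {n m : ℕ} (a : Fin m → EuclideanSpace ℝ (Fin n)) (y : Fin m → ℝ)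
    (j k : Fin n) : sampleCov a y j k = (m : ℝ)⁻¹ * ∑ i, y i * gramEntry j k (a i) := by
  simp [sampleCov, Matrix.sum_apply, Matrix.vecMulVec_apply, gramEntry]

/-- Dimension one is separate because `log (n / δ)` is bounded away from zero only for `n ≥ 2`. -/
lemma min_norm_le_of_subsingleton_coords {x v : EuclideanSpace ℝ (Fin 1)} (hx : ‖x‖ = 1)
    (hv : ‖v‖ = 1) : min ‖v - x‖ ‖v + x‖ = 0 := by
  have hx0 : |x 0| = 1 := by
    rw [EuclideanSpace.norm_eq] at hx
    rwa [Fin.sum_univ_one, Real.norm_eq_abs, Real.sqrt_sq (abs_nonneg _)] at hx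
  have hv0 : |v 0| = 1 := by
    rw [EuclideanSpace.norm_eq] at hv
    rwa [Fin.sum_univ_one, Real.norm_eq_abs, Real.sqrt_sq (abs_nonneg _)] at hv
  have h : v 0 = x 0 ∨ v 0 = -x 0 := abs_eq_abs.1 (hv0.trans hx0.symm)
  rcases h with h | h
  · have : v - x = 0 := by ext i; fin_cases i; simp [h]
    rw [this, norm_zero]; exact min_eq_left (norm_nonneg _)
  · have : v + x = 0 := by ext i; fin_cases i; simp [h]
    rw [this, norm_zero]; exact min_eq_right (norm_nonneg _)

end MPR

theorem theorem1 (K : ℝ≥0) :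
    ∃ C : ℝ, 0 < C ∧
      ∀ (n m s : ℕ) (Ω Ξ : Type*) [MeasurableSpace Ω] [MeasurableSpace Ξ]
        (P : Measure Ω) [IsProbabilityMeasure P] (ν : Measure Ξ) [IsProbabilityMeasure ν]
        (f : ℝ → Ξ → ℝ) (x : EuclideanSpace ℝ (Fin n))
        (a : Fin m → Ω → EuclideanSpace ℝ (Fin n)) (ξ : Fin m → Ω → Ξ) (ε δ : ℝ),
        Measurable (Function.uncurry f) →
        0 < MPR.linkCov f ν →
        MPR.linkPsiOne f ν ≤ K →
        MPR.IsSparse s x →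
        ‖x‖ = 1 →
        iIndepFun (fun i ω => (a i ω, ξ i ω)) P →
        (∀ i, HasLaw (fun ω => (a i ω, ξ i ω))
          ((stdGaussian (EuclideanSpace ℝ (Fin n))).prod ν) P) →
        0 < ε →
        0 < δ →
        C * max ((s : ℝ) ^ 2 * (Real.log (n / δ) + Real.log (s / δ) ^ 4) /
              (MPR.linkCov f ν ^ 2 * ε ^ 4))
            (max (s / δ) (Real.log (n / δ) * Real.log m ^ 2)) ≤ m →
        ∃ E : Set Ω, MeasurableSet E ∧ 1 - δ ≤ P.real E ∧
          ∀ ω ∈ E,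
            (∃ v, MPR.IsSparsePcaOutput s (fun i => a i ω)
              (fun i => f (inner ℝ (a i ω) x) (ξ i ω)) v) ∧
            ∀ v, MPR.IsSparsePcaOutput s (fun i => a i ω)
                (fun i => f (inner ℝ (a i ω) x) (ξ i ω)) v →
              min ‖v - x‖ ‖v + x‖ ≤ ε := by
  refine ⟨10 ^ 9 * ((K + 1 : ℝ≥0) : ℝ) ^ 2, by positivity, ?_⟩
  intro n m s Ω Ξ _ _ P _ ν _ f x a ξ ε δ hf hμ hK hsp hx hind hlaw hε hδ hm
  have hn : 0 < n := by
    rcases Nat.eq_zero_or_pos n with rfl | h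
    · rw [Subsingleton.elim x 0, norm_zero] at hx
      exact absurd hx zero_ne_one
    · exact h
  have hexists : ∀ ω, ∃ v, MPR.IsSparsePcaOutput s (fun i => a i ω)
      (fun i => f (inner ℝ (a i ω) x) (ξ i ω)) v := fun ω =>
    MPR.exists_isSparsePcaOutput hn hsp hx _ _
  rcases le_or_gt 1 δ with hδ1 | hδ1
  · exact ⟨∅, MeasurableSet.empty, by simpa using hδ1, fun ω hω => hω.elim⟩
  rcases Nat.lt_or_eq_of_le (Nat.succ_le_iff.2 hn) with hn2 | rfl
  swap
  · refine ⟨Set.univ, MeasurableSet.univ, by simpa using hδ.le, fun ω _ => ⟨hexists ω, ?_⟩⟩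
    rintro v ⟨X, -, hv⟩
    rw [MPR.min_norm_le_of_subsingleton_coords hx hv.1]
    exact hε.le
  have hs : 1 ≤ s := by
    rcases Nat.eq_zero_or_pos s with rfl | h
    · have h0 := Nat.le_zero.1 hsp
      rw [Set.ncard_eq_zero] at h0
      have : x = 0 := by
        ext j
        by_contra hj
        exact Set.eq_empty_iff_forall_notMem.1 h0 j hj
      rw [this, norm_zero] at hx
      exact absurd hx zero_ne_one
    · exact h
  set κ : ℝ≥0 := K + 1 with hκ
  have hκ1 : (1 : ℝ) ≤ κ := by rw [hκ]; push_cast; linarith [K.coe_nonneg]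
  have hκ0 : (0 : ℝ) < κ := by linarith
  obtain ⟨hm2, r, hr0, hrT, hprob, hbias⟩ :=
    MPR.exists_chernoff_parameter hn2 hs hκ1 hμ hε hδ hδ1 hm
  set T := 4 * (κ : ℝ) * Real.log m with hT
  set μ := MPR.linkCov f ν with hμdef
  set t := μ * ε ^ 2 / (8 * s) with ht
  set y : EuclideanSpace ℝ (Fin n) × Ξ → ℝ := fun p => f (inner ℝ x p.1) p.2 with hy
  set Q := (stdGaussian (EuclideanSpace ℝ (Fin n))).prod ν with hQ
  have hlawx := MPR.hasLaw_inner_prod (ν := ν) hx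
  have hym : Measurable y := hf.comp (by fun_prop :
    Measurable fun p : EuclideanSpace ℝ (Fin n) × Ξ => (inner ℝ x p.1, p.2))
  have hpsi := MPR.integrable_exp_of_psiOneNorm_le (κ := κ)
    (X := fun p : ℝ × Ξ => f p.1 p.2) hf hK (lt_add_one K)
  have hyi : Integrable (fun p => Real.exp (|y p| / κ)) Q := by
    have h := hpsi.1
    rw [← hlawx.map_eq] at h
    exact h.comp_aemeasurable hlawx.aemeasurable
  have hy2 : ∫ p, Real.exp (|y p| / κ) ∂Q ≤ 2 :=
    (hlawx.integral_comp hpsi.1.aestronglyMeasurable).trans_le hpsi.2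
  have hbad := MPR.measureReal_bad_le hind hlaw hym hκ0 hyi hy2 hr0 hrT (m * t / 2)
  set B : Set Ω := {ω | (∃ i, T < |y (a i ω, ξ i ω)|) ∨ ∃ j k, m * t / 2 ≤
        |∑ i, (MPR.truncMul y (fun p => MPR.gramEntry j k p.1) T (a i ω, ξ i ω) -
          ∫ q, MPR.truncMul y (fun p => MPR.gramEntry j k p.1) T q ∂Q)|} with hB
  -- The sampled variables are only almost everywhere measurable, so `B` is replaced by its
  -- measurable hull, of equal measure.
  refine ⟨(toMeasurable P B)ᶜ, (measurableSet_toMeasurable P B).compl, ?_, fun ω hω =>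
    ⟨hexists ω, ?_⟩⟩
  · rw [probReal_compl_eq_one_sub (measurableSet_toMeasurable P B), measureReal_def,
      measure_toMeasurable, ← measureReal_def]
    linarith [hbad.trans hprob]
  rintro v ⟨X, hX, hv⟩
  have hωB : ω ∉ B := fun h => hω (subset_toMeasurable P B h)
  simp only [hB, Set.mem_ofPred_eq, not_or, not_exists, not_lt, not_le] at hωB
  obtain ⟨hyT, hdev⟩ := hωB
  have hm0 : (0 : ℝ) < m := by exact_mod_cast (show 0 < m by omega)
  refine MPR.min_norm_le_of_entrywise hsp hx hμ hε.le (t := t) (fun j k => ?_) ?_ hX hv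
  · have h1 := hdev j k
    have hWi : Integrable (fun p : EuclideanSpace ℝ (Fin n) × Ξ =>
        Real.exp (|MPR.gramEntry j k p.1| / 4)) Q :=
      (MPR.integrable_exp_abs_gramEntry j k).1.comp_fst ν
    have hW : ∫ p : EuclideanSpace ℝ (Fin n) × Ξ,
        Real.exp (|MPR.gramEntry j k p.1| / 4) ∂Q ≤ 2 := by
      have h := integral_fun_fst (μ := stdGaussian (EuclideanSpace ℝ (Fin n))) (ν := ν)
        (fun a => Real.exp (|MPR.gramEntry j k a| / 4))
      rw [h]
      simpa using (MPR.integrable_exp_abs_gramEntry j k).2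
    have h2 := MPR.abs_integral_truncMul_sub_le hκ0 hym
      ((MPR.measurable_gramEntry j k).comp measurable_fst) hyi hWi hy2 hW T
    have h3 := MPR.integral_link_mul_gramEntry hx hf
      (MPR.memLp_two_of_integrable_exp hf hκ0 hpsi.1) j k
    set I := ∫ q, MPR.truncMul y (fun p => MPR.gramEntry j k p.1) T q ∂Q with hI
    -- Outside `B` no sample is truncated, so the entry splits into a centered truncated average and
    -- the truncated mean `I`; each contributes an error of at most `t / 2`.
    have e : MPR.sampleCov (fun i => a i ω) (fun i => f (inner ℝ (a i ω) x) (ξ i ω)) j k =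
        (m : ℝ)⁻¹ * ∑ i, (MPR.truncMul y (fun p => MPR.gramEntry j k p.1) T (a i ω, ξ i ω) - I) +
          I := by
      rw [MPR.sampleCov_apply, Finset.sum_sub_distrib, Finset.sum_const, Finset.card_univ,
        Fintype.card_fin, nsmul_eq_mul, mul_sub, inv_mul_cancel_left₀ hm0.ne', sub_add_cancel]
      congr 1
      refine Finset.sum_congr rfl fun i _ => ?_
      rw [MPR.truncMul, if_pos (hyT i), real_inner_comm]
    have h4 : |(m : ℝ)⁻¹ * ∑ i, (MPR.truncMul y (fun p => MPR.gramEntry j k p.1) T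
        (a i ω, ξ i ω) - I)| ≤ t / 2 := by
      rw [abs_mul, abs_of_pos (inv_pos.2 hm0), inv_mul_le_iff₀ hm0]
      linarith
    have h5 : |I - μ * (x j * x k)| ≤ t / 2 := by
      rw [← h3]
      exact h2.trans hbias
    rw [e, add_sub_assoc]
    exact (abs_add_le _ _).trans (by linarith)
  · have hs0 : (0 : ℝ) < s := by exact_mod_cast hs
    rw [ht]
    refine le_of_eq ?_
    field_simp
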